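/- Let $\mathbf k$ be a field. Let $\Delta^+=\{(x_1,x_2)\in\mathbb R^2 : x_1+x_2>0\}$ with the product order. A persistence module is a functor from the poset $\Delta^+$ to $\mathbf k$-vector spaces; for $s\in\mathbb R_{\ge 0}^2$ its shift is $M[s](x)=M(x+s)$. For $s=(s_1,s_2)\in\mathbb R_{>0}^2$ put $s_x=(s_1,0)$, $s_y=(0,s_2)$. A Mayer–Vietoris (MV) system $S=(S_i,\delta_i^s)$ consists of persistence modules $S_i$ ($i\in\mathbb Z$) and morphisms of persistence modules $\delta_i^s:S_i[s]\to S_{i-1}$ ($i\in\mathbb Z$, $s\in\mathbb R_{>0}^2$) such that for all $i$ and $s$ the sequence $$S_{i+1}[s]\xrightarrow{\delta_{i+1}^s}S_i\to S_i[s_x]\oplus S_i[s_y]\to S_i[s]\xrightarrow{\delta_i^s}S_{i-1}$$ is exact, where the unlabelled maps are $a\mapsto(a,-a)$ and $(a,b)\mapsto a+b$ (structural maps understood), and such that for $s\le s'$ the composite of the structural map $S_i[s]\to S_i[s']$ with $\delta_i^{s'}$ is $\delta_i^s$. A morphism of MV systems is a family of morphisms of persistence modules $S_i\to T_i$ that commutes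 with all the maps $\delta_i^s$. For $\varepsilon\ge 0$ write $\vec\varepsilon=(\varepsilon,\varepsilon)$ and $S[\vec\varepsilon]=(S_i[\vec\varepsilon],\delta_i^s[\vec\varepsilon])$. Two MV systems $S,T$ are $\varepsilon$-interleaved if there are morphisms of MV systems $f:S\to T[\vec\varepsilon]$ and $g:T\to S[\vec\varepsilon]$ such that $g[\vec\varepsilon]\circ f$ and $f[\vec\varepsilon]\circ g$ are the canonical translations $S\to S[2\vec\varepsilon]$ and $T\to T[2\vec\varepsilon]$. Put $$d_I^{MV}(S,T)=\inf\{\varepsilon\ge 0 : S,T\text{ are }\varepsilon\text{-interleaved}\}\in[0,\infty].$$ For a continuous function $h:X\to\mathbb R$ on a topological space let $M_i^h(x_1,x_2)=H_i\big(h^{-1}(]-x_1,x_2[);\mathbf k\big)$ (singular homology, zero for $i<0$), with structural maps induced by inclusions, and let $\delta_i^s$ at the point $x$ be the Mayer–Vietoris connecting map of the open cover of $h^{-1}(]-x_1-s_1,x_2+s_2[)$ by $h^{-1}(]-x_1-s_1,x_2[)$ and $h^{-1}(]-x_1,x_2+s_2[)$ (zero for $i\le 0$). Put $M^h=(M_i^h,\delta_i^s)$.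 Then for every topological space $X$ and all continuous functions $h_1,h_2:X\to\mathbb R$, the data $M^{h_1}$ and $M^{h_2}$ are MV systems, and $$d_I^{MV}(M^{h_1},M^{h_2})\le\sup_{x\in X}|h_1(x)-h_2(x)|,$$ where the supremum is taken in $[0,\infty]$ (so it is $0$ for empty $X$). -/

import Mathlib

open CategoryTheory CategoryTheory.Limits TopologicalSpace
open scoped NNReal ENNReal

universe u v w

noncomputable section

namespace MV

/-! ### The poset `Δ⁺` and persistence modules over it -/

/-- The open half plane `Δ⁺ = {(x, y) ∣ x + y > 0}` with the product order of `ℝ × ℝ`. -/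
abbrev DeltaPlus : Type := {p : ℝ × ℝ // 0 < p.1 + p.2}

/-- The translate `x + s` of a point `x` of `Δ⁺` by a vector `s` with nonnegative coordinates. -/
def DeltaPlus.add (x : DeltaPlus) (s : ℝ≥0 × ℝ≥0) : DeltaPlus :=
  ⟨(x.1.1 + s.1, x.1.2 + s.2), by
    have h := x.2
    have h1 := s.1.2
    have h2 := s.2.2
    show (0 : ℝ) < (x.1.1 + (s.1 : ℝ)) + (x.1.2 + (s.2 : ℝ))
    change (0 : ℝ) ≤ (s.1 : ℝ) at h1
    change (0 : ℝ) ≤ (s.2 : ℝ) at h2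
    linarith⟩

theorem DeltaPlus.add_le_add {x y : DeltaPlus} {s t : ℝ≥0 × ℝ≥0} (hxy : x ≤ y) (hst : s ≤ t) :
    x.add s ≤ y.add t :=
  ⟨_root_.add_le_add hxy.1 (NNReal.coe_le_coe.2 hst.1),
    _root_.add_le_add hxy.2 (NNReal.coe_le_coe.2 hst.2)⟩

theorem DeltaPlus.le_add (x : DeltaPlus) (s : ℝ≥0 × ℝ≥0) : x ≤ x.add s :=
  ⟨le_add_of_nonneg_right s.1.2, le_add_of_nonneg_right s.2.2⟩

theorem DeltaPlus.add_right_comm (x : DeltaPlus) (s t : ℝ≥0 × ℝ≥0) :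
    (x.add s).add t = (x.add t).add s := by
  apply Subtype.ext
  apply Prod.ext
  · exact _root_.add_right_comm x.1.1 _ _
  · exact _root_.add_right_comm x.1.2 _ _

/-- The vectors `s ∈ ℝ²_{>0}`, with the product order. -/
abbrev PosVec : Type := {s : ℝ≥0 × ℝ≥0 // 0 < s.1 ∧ 0 < s.2}

/-- `s_x = (s₁, 0)`. -/
def PosVec.x (s : PosVec) : ℝ≥0 × ℝ≥0 := (s.1.1, 0)

/-- `s_y = (0, s₂)`. -/
def PosVec.y (s : PosVec) : ℝ≥0 × ℝ≥0 := (0, s.1.2)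

theorem PosVec.x_le (s : PosVec) : s.x ≤ s.1 := ⟨le_refl _, zero_le⟩

theorem PosVec.y_le (s : PosVec) : s.y ≤ s.1 := ⟨zero_le, le_refl _⟩

/-- The diagonal vector `(ε, ε)`. -/
def diag (ε : ℝ≥0) : ℝ≥0 × ℝ≥0 := (ε, ε)

/-- The translation `x ↦ x + s` of the poset `Δ⁺`, as a functor. -/
def translation (s : ℝ≥0 × ℝ≥0) : DeltaPlus ⥤ DeltaPlus where
  obj x := x.add s
  map f := homOfLE (DeltaPlus.add_le_add (leOfHom f) le_rfl)

variable (k : Type w) [Field k]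

/-- Persistence modules over `Δ⁺`: functors from `Δ⁺` to `k`-vector spaces. -/
abbrev Pers := DeltaPlus ⥤ ModuleCat.{v} k

variable {k}

/-- The structural map `M(x) → M(y)`, for `x ≤ y`, as a `k`-linear map. -/
def Pers.str (M : Pers.{v} k) {x y : DeltaPlus} (h : x ≤ y) : M.obj x →ₗ[k] M.obj y :=
  (M.map (homOfLE h)).hom

/-- The shifted persistence module `M[s]`, with `M[s](x) = M(x + s)`. -/
def Pers.shift (M : Pers.{v} k) (s : ℝ≥0 × ℝ≥0) : Pers.{v} k := translation s ⋙ M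

/-- The map `M(x) → M(x + s_x) ⊕ M(x + s_y)`, `a ↦ (a, -a)`. -/
def Pers.diff (M : Pers.{v} k) (s : PosVec) (x : DeltaPlus) :
    M.obj x →ₗ[k] M.obj (x.add s.x) × M.obj (x.add s.y) :=
  (M.str (x.le_add s.x)).prod (-(M.str (x.le_add s.y)))

/-- The map `M(x + s_x) ⊕ M(x + s_y) → M(x + s)`, `(a, b) ↦ a + b`. -/
def Pers.sum (M : Pers.{v} k) (s : PosVec) (x : DeltaPlus) :
    M.obj (x.add s.x) × M.obj (x.add s.y) →ₗ[k] M.obj (x.add s.1) :=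
  (M.str (DeltaPlus.add_le_add (le_refl x) s.x_le)).coprod
    (M.str (DeltaPlus.add_le_add (le_refl x) s.y_le))

/-! ### Mayer-Vietoris systems -/

variable (k) in
/-- The data underlying a Mayer-Vietoris system: persistence modules `S_i`, `i ∈ ℤ`, and maps
`δ_{i+1}^s : S_{i+1}[s] → S_i`, given at each point `x` of `Δ⁺`. -/
structure MVData where
  /-- the persistence modules `S_i` -/
  mod : ℤ → Pers.{v} k
  /-- `δ i s x` is the map `δ_{i+1}^s` at the point `x` -/
  δ : ∀ (i : ℤ) (s : PosVec) (x : DeltaPlus),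
    (mod (i + 1)).obj (x.add s.1) →ₗ[k] (mod i).obj x

/-- The axioms of a Mayer-Vietoris system. Exactness is exactness at every point of `Δ⁺`. -/
structure MVData.IsMVSystem (S : MVData.{v} k) : Prop where
  /-- each `δ_{i+1}^s` is a morphism of persistence modules `S_{i+1}[s] → S_i` -/
  naturality : ∀ (i : ℤ) (s : PosVec) {x y : DeltaPlus} (h : x ≤ y),
    (S.mod i).str h ∘ₗ S.δ i s x =
      S.δ i s y ∘ₗ (S.mod (i + 1)).str (DeltaPlus.add_le_add h (le_refl s.1))
  /-- exactness of `S_{i+1}[s] → S_i → S_i[s_x] ⊕ S_i[s_y]` -/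
  exact_left : ∀ (i : ℤ) (s : PosVec) (x : DeltaPlus),
    Function.Exact (S.δ i s x) ((S.mod i).diff s x)
  /-- exactness of `S_i → S_i[s_x] ⊕ S_i[s_y] → S_i[s]` -/
  exact_middle : ∀ (i : ℤ) (s : PosVec) (x : DeltaPlus),
    Function.Exact ((S.mod i).diff s x) ((S.mod i).sum s x)
  /-- exactness of `S_{i+1}[s_x] ⊕ S_{i+1}[s_y] → S_{i+1}[s] → S_i` -/
  exact_right : ∀ (i : ℤ) (s : PosVec) (x : DeltaPlus),
    Function.Exact ((S.mod (i + 1)).sum s x) (S.δ i s x)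
  /-- compatibility of `δ_{i+1}^s` and `δ_{i+1}^t` for `s ≤ t` -/
  compat : ∀ (i : ℤ) {s t : PosVec} (h : s ≤ t) (x : DeltaPlus),
    S.δ i t x ∘ₗ (S.mod (i + 1)).str (DeltaPlus.add_le_add (le_refl x) h) = S.δ i s x

variable (k) in
/-- Mayer-Vietoris systems over `ℝ`, the objects of the category `M-V(ℝ)`. -/
structure MVSystem extends MVData.{v} k where
  isMV : toMVData.IsMVSystem

/-- Morphisms of Mayer-Vietoris systems: morphisms of persistence modules `S_i → T_i`, `i ∈ ℤ`,
that commute with the connecting maps. -/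
structure MVSystem.Hom (S T : MVSystem.{v} k) where
  /-- the components `φ_i : S_i → T_i` -/
  app : ∀ i : ℤ, S.mod i ⟶ T.mod i
  comm : ∀ (i : ℤ) (s : PosVec) (x : DeltaPlus),
    ((app i).app x).hom ∘ₗ S.δ i s x = T.δ i s x ∘ₗ ((app (i + 1)).app (x.add s.1)).hom

/-- The data of the shift `S[v]`. The map `δ^s[v]` at `x` is `δ^s` at `x + v`, precomposed with
the identification `S_{i+1}(x + s + v) = S_{i+1}(x + v + s)`. -/
def MVData.shift (S : MVData.{v} k) (v : ℝ≥0 × ℝ≥0) : MVData.{v} k where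
  mod i := (S.mod i).shift v
  δ i s x := S.δ i s (x.add v) ∘ₗ (S.mod (i + 1)).str (DeltaPlus.add_right_comm x s.1 v).le

theorem Pers.str_str (M : Pers.{v} k) {x y z : DeltaPlus} (h : x ≤ y) (h' : y ≤ z)
    (a : M.obj x) : M.str h' (M.str h a) = M.str (h.trans h') a := by
  unfold Pers.str
  rw [← LinearMap.comp_apply, ← ModuleCat.hom_comp, ← M.map_comp]
  rfl

theorem Pers.str_self (M : Pers.{v} k) {x : DeltaPlus} (h : x ≤ x) :
    M.str h = LinearMap.id := by
  unfold Pers.str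
  rw [show homOfLE h = 𝟙 x from rfl, M.map_id]
  rfl

theorem Pers.exact_diff_congr (M : Pers.{v} k) {A : Type v} [AddCommGroup A] [Module k A]
    {x a b a' b' : DeltaPlus} (hxa : x ≤ a) (hxb : x ≤ b) (ea : a = a') (eb : b = b')
    (hxa' : x ≤ a') (hxb' : x ≤ b') (α : A →ₗ[k] M.obj x)
    (h : Function.Exact α ((M.str hxa).prod (-(M.str hxb)))) :
    Function.Exact α ((M.str hxa').prod (-(M.str hxb'))) := by
  subst ea eb
  exact h

theorem Pers.exact_diff_sum_congr (M : Pers.{v} k) {x a b c a' b' c' : DeltaPlus}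
    (hxa : x ≤ a) (hxb : x ≤ b) (hac : a ≤ c) (hbc : b ≤ c)
    (ea : a = a') (eb : b = b') (ec : c = c')
    (hxa' : x ≤ a') (hxb' : x ≤ b') (hac' : a' ≤ c') (hbc' : b' ≤ c')
    (h : Function.Exact ((M.str hxa).prod (-(M.str hxb))) ((M.str hac).coprod (M.str hbc))) :
    Function.Exact ((M.str hxa').prod (-(M.str hxb')))
      ((M.str hac').coprod (M.str hbc')) := by
  subst ea eb ec
  exact h

theorem Pers.exact_sum_congr (M : Pers.{v} k) {B : Type v} [AddCommGroup B] [Module k B]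
    {a b c a' b' c' : DeltaPlus} (hac : a ≤ c) (hbc : b ≤ c)
    (ea : a = a') (eb : b = b') (ec : c = c') (hac' : a' ≤ c') (hbc' : b' ≤ c') (e : c' ≤ c)
    (β : M.obj c →ₗ[k] B)
    (h : Function.Exact ((M.str hac).coprod (M.str hbc)) β) :
    Function.Exact ((M.str hac').coprod (M.str hbc')) (β ∘ₗ M.str e) := by
  subst ea eb ec
  rw [M.str_self e]
  exact h

theorem MVData.IsMVSystem.shift {S : MVData.{v} k} (hS : S.IsMVSystem) (v : ℝ≥0 × ℝ≥0) :
    (S.shift v).IsMVSystem where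
  naturality i s x y h := by
    have h1 := hS.naturality i s (DeltaPlus.add_le_add h (le_refl v))
    refine LinearMap.ext fun a => ?_
    refine (LinearMap.congr_fun h1 ((S.mod (i + 1)).str
      (DeltaPlus.add_right_comm x s.1 v).le a)).trans ?_
    refine congrArg (S.δ i s (y.add v)) ?_
    exact ((S.mod (i + 1)).str_str _ _ a).trans ((S.mod (i + 1)).str_str _ _ a).symm
  exact_left i s x := by
    intro b
    have h := Pers.exact_diff_congr (S.mod i) _ _ (DeltaPlus.add_right_comm x v s.x)
      (DeltaPlus.add_right_comm x v s.y)
      (DeltaPlus.add_le_add (x.le_add s.x) (le_refl v))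
      (DeltaPlus.add_le_add (x.le_add s.y) (le_refl v)) _ (hS.exact_left i s (x.add v)) b
    refine h.trans ⟨?_, ?_⟩
    · rintro ⟨a, rfl⟩
      refine ⟨(S.mod (i + 1)).str (DeltaPlus.add_right_comm x v s.1).le a, ?_⟩
      refine congrArg (S.δ i s (x.add v)) ?_
      exact ((S.mod (i + 1)).str_str _ _ a).trans
        (LinearMap.congr_fun ((S.mod (i + 1)).str_self _) a)
    · rintro ⟨a, rfl⟩
      exact ⟨_, rfl⟩
  exact_middle i s x :=
    Pers.exact_diff_sum_congr (S.mod i) _ _ _ _ (DeltaPlus.add_right_comm x v s.x)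
      (DeltaPlus.add_right_comm x v s.y) (DeltaPlus.add_right_comm x v s.1) _ _ _ _
      (hS.exact_middle i s (x.add v))
  exact_right i s x :=
    Pers.exact_sum_congr (S.mod (i + 1)) _ _ (DeltaPlus.add_right_comm x v s.x)
      (DeltaPlus.add_right_comm x v s.y) (DeltaPlus.add_right_comm x v s.1) _ _ _ _
      (hS.exact_right i s (x.add v))
  compat i s t h x := by
    have h1 := hS.compat i h (x.add v)
    refine LinearMap.ext fun a => ?_
    refine Eq.trans ?_ (LinearMap.congr_fun h1 ((S.mod (i + 1)).str
      (DeltaPlus.add_right_comm x s.1 v).le a))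
    refine congrArg (S.δ i t (x.add v)) ?_
    exact ((S.mod (i + 1)).str_str _ _ a).trans ((S.mod (i + 1)).str_str _ _ a).symm

/-- The shifted Mayer-Vietoris system `S[v]`. -/
def MVSystem.shift (S : MVSystem.{v} k) (v : ℝ≥0 × ℝ≥0) : MVSystem.{v} k where
  toMVData := S.toMVData.shift v
  isMV := S.isMV.shift v

/-! ### Interleavings and the interleaving distance -/

/-- `S` and `T` are `ε`-interleaved: there are morphisms of Mayer-Vietoris systems
`f : S → T[(ε, ε)]` and `g : T → S[(ε, ε)]` such that both composites `g[(ε, ε)] ∘ f` and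
`f[(ε, ε)] ∘ g` are the canonical translations by `(2ε, 2ε)`, that is, are given at every point
`x` by the structural map from `x` to `x + (ε, ε) + (ε, ε)`. -/
def MVSystem.Interleaved (ε : ℝ≥0) (S T : MVSystem.{v} k) : Prop :=
  ∃ (f : S.Hom (T.shift (diag ε))) (g : T.Hom (S.shift (diag ε))),
    (∀ (i : ℤ) (x : DeltaPlus),
      ((g.app i).app (x.add (diag ε))).hom ∘ₗ ((f.app i).app x).hom =
        (S.mod i).str ((x.le_add (diag ε)).trans (DeltaPlus.le_add _ (diag ε)))) ∧
    (∀ (i : ℤ) (x : DeltaPlus),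
      ((f.app i).app (x.add (diag ε))).hom ∘ₗ ((g.app i).app x).hom =
        (T.mod i).str ((x.le_add (diag ε)).trans (DeltaPlus.le_add _ (diag ε))))

/-- The interleaving distance `d_I^{MV}(S, T)`, with values in `[0, ∞]`. -/
def MVSystem.dI (S T : MVSystem.{v} k) : ℝ≥0∞ :=
  ⨅ (ε : ℝ≥0) (_ : MVSystem.Interleaved ε S T), (ε : ℝ≥0∞)

/-! ### The Mayer-Vietoris connecting map in singular homology -/

variable (k) in
/-- The field `k` as a vector space over itself, in a universe large enough for singular chains
on spaces in `Type u`. -/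
abbrev coeff : ModuleCat.{max w u} k := ModuleCat.of k (ULift.{u} k)

variable (k) in
/-- The singular chain complex with coefficients in `k`. -/
abbrev singularChains : TopCat.{u} ⥤ ChainComplex (ModuleCat.{max w u} k) ℕ :=
  (AlgebraicTopology.singularChainComplexFunctor (ModuleCat.{max w u} k)).obj (coeff.{u} k)

variable (k) in
/-- The `n`-th singular homology with coefficients in `k`. -/
abbrev singularHomology (n : ℕ) : TopCat.{u} ⥤ ModuleCat.{max w u} k :=
  (AlgebraicTopology.singularHomologyFunctor (ModuleCat.{max w u} k) n).obj (coeff.{u} k)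

section MayerVietoris

variable {X : Type u} [TopologicalSpace X]

variable (k) in
/-- Singular chains of the open subsets of `X`. -/
abbrev chains (U : Opens X) : ChainComplex (ModuleCat.{max w u} k) ℕ :=
  (singularChains.{u} k).obj ((Opens.toTopCat (TopCat.of X)).obj U)

variable (k) in
/-- The chain map `C(U) → C(V)` induced by an inclusion `U ⊆ V`. -/
abbrev chainsMap {U V : Opens X} (h : U ≤ V) : chains.{u} k U ⟶ chains.{u} k V :=
  (singularChains.{u} k).map ((Opens.toTopCat (TopCat.of X)).map (homOfLE h))

variable (k) in
/-- The `n`-th singular homology of the open subsets of `X`, as a functor. -/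
abbrev homologyOpens (X : Type u) [TopologicalSpace X] (n : ℕ) :
    Opens X ⥤ ModuleCat.{max w u} k :=
  Opens.toTopCat (TopCat.of X) ⋙ singularHomology.{u} k n

variable (k) in
/-- The chain map `C(U ∩ V) → C(U) ⊕ C(V)`, `c ↦ (c, -c)`. -/
def chainsDiff (U V : Opens X) :
    chains.{u} k (U ⊓ V) ⟶ chains.{u} k U ⊞ chains.{u} k V :=
  biprod.lift (chainsMap.{u} k inf_le_left) (-(chainsMap.{u} k inf_le_right))

variable (k) in
/-- The chain map `C(U) ⊕ C(V) → C(U ∪ V)`, `(a, b) ↦ a + b`. -/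
def chainsSum (U V : Opens X) :
    chains.{u} k U ⊞ chains.{u} k V ⟶ chains.{u} k (U ⊔ V) :=
  biprod.desc (chainsMap.{u} k le_sup_left) (chainsMap.{u} k le_sup_right)

theorem chainsDiff_chainsSum (U V : Opens X) :
    chainsDiff.{u} k U V ≫ chainsSum.{u} k U V = 0 := by
  unfold chainsDiff chainsSum
  rw [biprod.lift_desc, Preadditive.neg_comp, ← Functor.map_comp, ← Functor.map_comp,
    ← Functor.map_comp, ← Functor.map_comp]
  exact add_neg_cancel _

instance (U V : Opens X) : Mono (chainsDiff.{u} k U V) := by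
  have : Mono ((Opens.toTopCat (TopCat.of X)).map (homOfLE (inf_le_left : U ⊓ V ≤ U))) := by
    rw [TopCat.mono_iff_injective]
    intro a b h
    have h' : (⟨a.1, a.2.1⟩ : (U : Set X)) = ⟨b.1, b.2.1⟩ := h
    have h'' : a.1 = b.1 := congrArg (fun z : (U : Set X) => z.1) h'
    exact Subtype.ext h''
  have h : Mono (chainsDiff.{u} k U V ≫ biprod.fst) := by
    unfold chainsDiff
    rw [biprod.lift_fst]
    infer_instance
  exact mono_of_mono _ biprod.fst

variable (k) in
/-- The short complex `0 → C(U ∩ V) → C(U) ⊕ C(V) → (C(U) ⊕ C(V)) / C(U ∩ V) → 0`. The quotient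
is the complex of small chains `C(U) + C(V) ⊆ C(U ∪ V)`. -/
def mvComplex (U V : Opens X) : ShortComplex (ChainComplex (ModuleCat.{max w u} k) ℕ) :=
  ShortComplex.mk (chainsDiff.{u} k U V) (cokernel.π (chainsDiff.{u} k U V))
    (cokernel.condition _)

theorem mvComplex_shortExact (U V : Opens X) : (mvComplex.{u} k U V).ShortExact where
  exact := ShortComplex.exact_cokernel _
  mono_f := inferInstanceAs (Mono (chainsDiff.{u} k U V))
  epi_g := inferInstanceAs (Epi (cokernel.π (chainsDiff.{u} k U V)))

variable (k) in
/-- The chain map from the small chains to `C(U ∪ V)` induced by `(a, b) ↦ a + b`. -/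
def smallChainsMap (U V : Opens X) : (mvComplex.{u} k U V).X₃ ⟶ chains.{u} k (U ⊔ V) :=
  cokernel.desc _ (chainsSum.{u} k U V) (chainsDiff_chainsSum U V)

variable (k) in
/-- The map induced by `smallChainsMap` on `n`-th homology. -/
def smallHomologyMap (U V : Opens X) (n : ℕ) :
    (mvComplex.{u} k U V).X₃.homology n ⟶ (homologyOpens.{u} k X n).obj (U ⊔ V) :=
  HomologicalComplex.homologyMap (smallChainsMap.{u} k U V) n

open Classical in
variable (k) in
/-- The Mayer-Vietoris connecting map `H_{n+1}(U ∪ V) → H_n(U ∩ V)`: the inverse of the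
isomorphism from the homology of the small chains to `H_{n+1}(U ∪ V)`, followed by the connecting
map of the short exact sequence above. In other words, the class of a cycle `a + b` with `a` a
chain of `U` and `b` a chain of `V` is sent to the class of `∂a`. (For open `U` and `V` the map
`smallChainsMap` is always a quasi-isomorphism, so the second branch never occurs.) -/
def mvConnecting (U V : Opens X) (n : ℕ) :
    (homologyOpens.{u} k X (n + 1)).obj (U ⊔ V) ⟶ (homologyOpens.{u} k X n).obj (U ⊓ V) :=
  if _h : IsIso (smallHomologyMap.{u} k U V (n + 1)) then
    inv (smallHomologyMap.{u} k U V (n + 1)) ≫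
      (mvComplex_shortExact.{u} U V).δ (n + 1) n rfl
  else 0

end MayerVietoris

/-! ### The Mayer-Vietoris system of a continuous function -/

section LevelSets

variable {X : Type u} [TopologicalSpace X]

/-- The open set `h⁻¹(]-x₁, x₂[)`, for `x = (x₁, x₂)` in `Δ⁺`. -/
def levelSet (h : C(X, ℝ)) (x : DeltaPlus) : Opens X :=
  ⟨h ⁻¹' Set.Ioo (-x.1.1) x.1.2, isOpen_Ioo.preimage h.continuous⟩

theorem levelSet_mono (h : C(X, ℝ)) {x y : DeltaPlus} (hxy : x ≤ y) :
    levelSet h x ≤ levelSet h y :=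
  fun _ ha => ⟨(neg_le_neg hxy.1).trans_lt ha.1, ha.2.trans_le hxy.2⟩

theorem levelSet_le_sup (h : C(X, ℝ)) (s : PosVec) (x : DeltaPlus) :
    levelSet h (x.add s.1) ≤ levelSet h (x.add s.x) ⊔ levelSet h (x.add s.y) := by
  rintro a ⟨h1, h2⟩
  have hx := x.2
  simp only [DeltaPlus.add] at h1 h2
  by_cases ha : h a < x.1.2
  · exact Or.inl ⟨h1, by simpa [DeltaPlus.add, PosVec.x] using ha⟩
  · refine Or.inr ⟨?_, h2⟩
    simp only [DeltaPlus.add, PosVec.y, NNReal.coe_zero, add_zero]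
    linarith

theorem levelSet_inf_le (h : C(X, ℝ)) (s : PosVec) (x : DeltaPlus) :
    levelSet h (x.add s.x) ⊓ levelSet h (x.add s.y) ≤ levelSet h x := by
  rintro a ⟨⟨_, h1⟩, ⟨h2, _⟩⟩
  simp only [DeltaPlus.add, PosVec.x, PosVec.y, NNReal.coe_zero, add_zero] at h1 h2
  exact ⟨h2, h1⟩

/-- The functor `x ↦ h⁻¹(]-x₁, x₂[)` from `Δ⁺` to the open subsets of `X`. -/
def levelSetFunctor (h : C(X, ℝ)) : DeltaPlus ⥤ Opens X where
  obj := levelSet h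
  map f := homOfLE (levelSet_mono h (leOfHom f))

variable (k) in
/-- The level set persistence module `M_i^h`, with `M_i^h(x) = H_i(h⁻¹(]-x₁, x₂[))`; it is zero
for `i < 0`. -/
def levelSetPers (h : C(X, ℝ)) : ℤ → Pers.{max w u} k
  | Int.ofNat n => levelSetFunctor h ⋙ homologyOpens.{u} k X n
  | Int.negSucc _ => (Functor.const _).obj (ModuleCat.of k PUnit)

variable (k) in
/-- The maps `δ_{i+1}^s : M_{i+1}^h(x + s) → M_i^h(x)`: the Mayer-Vietoris connecting map of the
cover of `h⁻¹(]-x₁-s₁, x₂+s₂[)` by `h⁻¹(]-x₁-s₁, x₂[)` and `h⁻¹(]-x₁, x₂+s₂[)`, whose intersection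
is `h⁻¹(]-x₁, x₂[)`; it is zero if `i < 0`. -/
def levelSetδ (h : C(X, ℝ)) : ∀ (i : ℤ) (s : PosVec) (x : DeltaPlus),
    (levelSetPers.{u} k h (i + 1)).obj (x.add s.1) →ₗ[k] (levelSetPers.{u} k h i).obj x
  | Int.ofNat n => fun s x =>
      ((homologyOpens.{u} k X (n + 1)).map (homOfLE (levelSet_le_sup h s x)) ≫
        mvConnecting.{u} k (levelSet h (x.add s.x)) (levelSet h (x.add s.y)) n ≫
        (homologyOpens.{u} k X n).map (homOfLE (levelSet_inf_le h s x))).hom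
  | Int.negSucc _ => fun _ _ => 0

variable (k) in
/-- The data `M^h = (M_i^h, δ_i^s)` associated to a continuous function `h : X → ℝ`. -/
def levelSetData (h : C(X, ℝ)) : MVData.{max w u} k where
  mod := levelSetPers.{u} k h
  δ := levelSetδ.{u} k h

end LevelSets

end MV

end

/-!
# The level set Mayer-Vietoris systems of two functions are interleaved

The inclusions `h₁⁻¹(]-x₁, x₂[) ⊆ h₂⁻¹(]-x₁-ε, x₂+ε[)`, which hold if `|h₁ - h₂| ≤ ε`, and the same
inclusions with `h₁` and `h₂` exchanged, induce an `ε`-interleaving (`interleaved_levelSetSystem`),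
since the Mayer-Vietoris connecting maps are natural (`connecting_naturality`). If the supremum of
`|h₁ - h₂|` is finite, it is itself an admissible `ε`; otherwise there is nothing to prove.

The substance lies in `levelSetData_isMVSystem`, that is, in the exactness of the Mayer-Vietoris
sequence of two open sets `U` and `V`. It is the homology sequence of `0 → C(U ∩ V) → C(U) ⊕ C(V) →
C(U) + C(V) → 0`, provided that the small chains `C(U) + C(V)` compute the homology of `U ∪ V`
(`isIso_smallHomologyMap`). The map from the abstract quotient to `C(U ∪ V)` is injective because
singular simplices form a basis, and then it suffices that every chain `z` of `U ∪ V` with small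
boundary is small up to a boundary (`exists_sub_d_mem_smallChains`).

This follows from barycentric subdivision `S` and a chain homotopy `T` with `dT + Td = 1 - S`, both
natural: naturality makes `S` and `T` preserve small chains, so `z` and `S z` differ by a boundary
and a small chain, and some iterate `S^m z` is small by Lebesgue's number lemma.

The operators are first built on formal combinations of tuples of points of a set in which every
nonempty tuple `v` has a chosen centre `b(v)`, by the recursions `S v = b(v) * S(∂v)` and
`T v = b(v) * (v - T(∂v))`, where `*` is the cone. In the complex that is augmented by the empty
tuple, the cone formula `∂(p * c) = c - p * ∂c` has no exceptional case on nonempty tuples, and it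
is, with `∂∂ = 0`, all that the identity `∂T + T∂ = 1 - S` needs (`TupleChain.boundary_homotopy`).
Tuples of points of the standard simplex are then turned into affine simplices, and composed with
singular simplices (`realize`).
-/

noncomputable section

namespace MV

/-! ### Augmented chains of vertex tuples and their subdivision -/

/-- Formal `k`-linear combinations of `n`-tuples of points of `P`. The index is the number of
vertices, so `TupleChain k P 0` is the augmentation term `k`, and `TupleChain k P (n + 1)` holds
the chains of dimension `n`. -/
abbrev TupleChain (k : Type w) [Field k] (P : Type v) (n : ℕ) : Type max v w :=
  (Fin n → P) →₀ k

namespace TupleChain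

variable {k : Type w} [Field k] {P : Type v} {Q : Type u} {n : ℕ}

variable (k) in
/-- The basis element given by a tuple. -/
abbrev of (v : Fin n → P) : TupleChain k P n := Finsupp.single v 1

variable (k) in
/-- The linear map with prescribed values on tuples. -/
abbrev lift {M : Type*} [AddCommGroup M] [Module k M] (f : (Fin n → P) → M) :
    TupleChain k P n →ₗ[k] M := Finsupp.linearCombination k f

theorem lift_of {M : Type*} [AddCommGroup M] [Module k M] (f : (Fin n → P) → M) (v : Fin n → P) :
    lift k f (of k v) = f v := by simp

theorem hom_ext {M : Type*} [AddCommGroup M] [Module k M] {f g : TupleChain k P n →ₗ[k] M}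
    (h : ∀ v, f (of k v) = g (of k v)) : f = g :=
  Finsupp.lhom_ext' fun v => LinearMap.ext_ring (h v)

variable (k P) in
/-- The alternating sum of the faces of a tuple. From one-element tuples it is the
augmentation. -/
def boundary (n : ℕ) : TupleChain k P (n + 1) →ₗ[k] TupleChain k P n :=
  lift k fun v => ∑ i : Fin (n + 1), (-1 : k) ^ (i : ℕ) • of k (v ∘ i.succAbove)

/-- The cone with apex `p`. -/
def cone (p : P) (n : ℕ) : TupleChain k P n →ₗ[k] TupleChain k P (n + 1) :=
  lift k fun v => of k (Fin.cons p v)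

variable (k) in
/-- The map on tuples induced by a map of vertices. -/
def map (f : P → Q) (n : ℕ) : TupleChain k P n →ₗ[k] TupleChain k Q n :=
  lift k fun v => of k (f ∘ v)

theorem boundary_of (v : Fin (n + 1) → P) :
    boundary k P n (of k v) = ∑ i : Fin (n + 1), (-1 : k) ^ (i : ℕ) • of k (v ∘ i.succAbove) :=
  lift_of _ v

theorem cone_of (p : P) (v : Fin n → P) : cone p n (of k v) = of k (Fin.cons p v) := lift_of _ v

theorem map_of (f : P → Q) (v : Fin n → P) : map k f n (of k v) = of k (f ∘ v) := lift_of _ v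

theorem boundary_cone_zero (p : P) (c : TupleChain k P 0) :
    boundary k P 0 (cone p 0 c) = c := by
  suffices h : boundary k P 0 ∘ₗ cone p 0 = LinearMap.id from LinearMap.congr_fun h c
  refine hom_ext fun v => ?_
  simp only [LinearMap.comp_apply, cone_of, boundary_of, LinearMap.id_apply]
  rw [Fin.sum_univ_succ, Fin.sum_univ_zero, add_zero, Fin.val_zero, pow_zero, one_smul]
  congr 1

theorem boundary_cone (p : P) (c : TupleChain k P (n + 1)) :
    boundary k P (n + 1) (cone p (n + 1) c) = c - cone p n (boundary k P n c) := by
  suffices h : boundary k P (n + 1) ∘ₗ cone p (n + 1) =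
      LinearMap.id - cone p n ∘ₗ boundary k P n from LinearMap.congr_fun h c
  refine hom_ext fun v => ?_
  simp only [LinearMap.comp_apply, cone_of, boundary_of, LinearMap.id_apply, LinearMap.sub_apply,
    map_sum, map_smul]
  rw [Fin.sum_univ_succ, sub_eq_add_neg, ← Finset.sum_neg_distrib]
  congr 1
  · simp only [Fin.val_zero, pow_zero, one_smul]
    congr 1
  · refine Finset.sum_congr rfl fun i _ => ?_
    rw [Fin.val_succ, pow_succ, mul_neg_one, neg_smul]
    congr 3
    funext j
    refine Fin.cases ?_ (fun j => ?_) j <;> simp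

theorem boundary_comp_boundary (n : ℕ) : boundary k P n ∘ₗ boundary k P (n + 1) = 0 := by
  -- A tuple is the cone from its head over its tail, so the cone formula gives an induction.
  induction n with
  | zero =>
    refine hom_ext fun v => ?_
    rw [LinearMap.comp_apply, ← Fin.cons_self_tail v, ← cone_of, boundary_cone, map_sub,
      boundary_cone_zero, sub_self, LinearMap.zero_apply]
  | succ n ih =>
    refine hom_ext fun v => ?_
    rw [LinearMap.comp_apply, ← Fin.cons_self_tail v, ← cone_of, boundary_cone, map_sub,
      boundary_cone, ← LinearMap.comp_apply (boundary k P n), ih]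
    simp

theorem boundary_boundary (c : TupleChain k P (n + 2)) :
    boundary k P n (boundary k P (n + 1) c) = 0 :=
  LinearMap.congr_fun (boundary_comp_boundary n) c

theorem map_boundary (f : P → Q) (c : TupleChain k P (n + 1)) :
    map k f n (boundary k P n c) = boundary k Q n (map k f (n + 1) c) := by
  suffices h : map k f n ∘ₗ boundary k P n = boundary k Q n ∘ₗ map k f (n + 1) from
    LinearMap.congr_fun h c
  refine hom_ext fun v => ?_
  simp only [LinearMap.comp_apply, map_of, boundary_of, map_sum, map_smul]
  rfl

theorem map_cone (f : P → Q) (p : P) (c : TupleChain k P n) :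
    map k f (n + 1) (cone p n c) = cone (f p) n (map k f n c) := by
  suffices h : map k f (n + 1) ∘ₗ cone p n = cone (f p) n ∘ₗ map k f n from
    LinearMap.congr_fun h c
  refine hom_ext fun v => ?_
  simp only [LinearMap.comp_apply, map_of, cone_of]
  congr 1
  funext j
  refine Fin.cases ?_ (fun j => ?_) j <;> simp

section Subdivision

variable (b : ∀ n : ℕ, (Fin (n + 1) → P) → P) (b' : ∀ n : ℕ, (Fin (n + 1) → Q) → Q)

variable (k) in
/-- The subdivision operator for a choice `b` of a centre for every nonempty tuple: a tuple is
sent to the cone, with apex its centre, over the subdivision of its boundary. -/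
def subdivision : ∀ n : ℕ, TupleChain k P n →ₗ[k] TupleChain k P n
  | 0 => LinearMap.id
  | n + 1 => lift k fun v => cone (b n v) n (subdivision n (boundary k P n (of k v)))

variable (k) in
/-- The chain homotopy from the identity to `subdivision`. -/
def homotopy : ∀ n : ℕ, TupleChain k P n →ₗ[k] TupleChain k P (n + 1)
  | 0 => 0
  | n + 1 => lift k fun v =>
      cone (b n v) (n + 1) (of k v - homotopy n (boundary k P n (of k v)))

theorem subdivision_of (v : Fin (n + 1) → P) : subdivision k b (n + 1) (of k v) =
    cone (b n v) n (subdivision k b n (boundary k P n (of k v))) :=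
  lift_of _ v

theorem homotopy_of (v : Fin (n + 1) → P) : homotopy k b (n + 1) (of k v) =
    cone (b n v) (n + 1) (of k v - homotopy k b n (boundary k P n (of k v))) :=
  lift_of _ v

theorem boundary_homotopy (c : TupleChain k P (n + 1)) :
    boundary k P (n + 1) (homotopy k b (n + 1) c) + homotopy k b n (boundary k P n c) =
      c - subdivision k b (n + 1) c := by
  suffices h : ∀ n, boundary k P (n + 1) ∘ₗ homotopy k b (n + 1) +
      homotopy k b n ∘ₗ boundary k P n = LinearMap.id - subdivision k b (n + 1) from
    LinearMap.congr_fun (h n) c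
  intro n
  induction n with
  | zero =>
    refine hom_ext fun v => ?_
    simp only [LinearMap.add_apply, LinearMap.comp_apply, LinearMap.sub_apply, LinearMap.id_apply,
      homotopy_of, subdivision_of, boundary_cone]
    simp [homotopy, subdivision]
  | succ n ih =>
    refine hom_ext fun v => ?_
    have h := LinearMap.congr_fun ih (boundary k P (n + 1) (of k v))
    simp only [LinearMap.add_apply, LinearMap.comp_apply, LinearMap.sub_apply, LinearMap.id_apply,
      boundary_boundary, map_zero, add_zero] at h
    simp only [LinearMap.add_apply, LinearMap.comp_apply, LinearMap.sub_apply, LinearMap.id_apply,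
      homotopy_of b v, subdivision_of b v, boundary_cone, map_sub, h]
    abel

variable {b b'}

theorem map_subdivision (f : P → Q) (hf : ∀ n v, f (b n v) = b' n (f ∘ v)) :
    ∀ (n : ℕ) (c : TupleChain k P n),
      map k f n (subdivision k b n c) = subdivision k b' n (map k f n c)
  | 0, _ => rfl
  | n + 1, c => by
    suffices h : map k f (n + 1) ∘ₗ subdivision k b (n + 1) =
        subdivision k b' (n + 1) ∘ₗ map k f (n + 1) from LinearMap.congr_fun h c
    refine hom_ext fun v => ?_
    simp only [LinearMap.comp_apply, map_of, subdivision_of, map_cone, hf,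
      map_subdivision f hf n, map_boundary]

theorem map_homotopy (f : P → Q) (hf : ∀ n v, f (b n v) = b' n (f ∘ v)) :
    ∀ (n : ℕ) (c : TupleChain k P n),
      map k f (n + 1) (homotopy k b n c) = homotopy k b' n (map k f n c)
  | 0, _ => by simp [homotopy]
  | n + 1, c => by
    suffices h : map k f (n + 2) ∘ₗ homotopy k b (n + 1) =
        homotopy k b' (n + 1) ∘ₗ map k f (n + 1) from LinearMap.congr_fun h c
    refine hom_ext fun v => ?_
    simp only [LinearMap.comp_apply, map_of, homotopy_of, map_cone, hf, map_sub,
      map_homotopy f hf n, map_boundary]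

end Subdivision

end TupleChain

/-! ### Affine maps between standard simplices and the mesh of the barycentric subdivision -/

section Affine

variable {ι κ μ : Type*} [Fintype ι] [Fintype κ] [Fintype μ]

/-- The affine map between standard simplices that sends the vertices to the points `v i`. -/
def affineMap (v : ι → stdSimplex ℝ κ) (x : stdSimplex ℝ ι) : stdSimplex ℝ κ :=
  ⟨fun c => ∑ i, x i * v i c, fun c => Finset.sum_nonneg fun i _ =>
      mul_nonneg (stdSimplex.zero_le x i) (stdSimplex.zero_le (v i) c), by
    rw [Finset.sum_comm]
    simp only [← Finset.mul_sum, stdSimplex.sum_eq_one, mul_one]⟩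

theorem affineMap_apply (v : ι → stdSimplex ℝ κ) (x : stdSimplex ℝ ι) (c : κ) :
    affineMap v x c = ∑ i, x i * v i c := rfl

theorem affineMap_affineMap (w : κ → stdSimplex ℝ μ) (v : ι → stdSimplex ℝ κ)
    (x : stdSimplex ℝ ι) : affineMap w (affineMap v x) = affineMap (affineMap w ∘ v) x := by
  ext c
  simp only [affineMap_apply, Function.comp_apply, Finset.sum_mul, Finset.mul_sum]
  rw [Finset.sum_comm]
  simp only [mul_assoc]

theorem affineMap_vertex [DecidableEq ι] (v : ι → stdSimplex ℝ κ) (i : ι) :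
    affineMap v (stdSimplex.vertex i) = v i := by
  ext c
  simp [affineMap_apply, Pi.single_apply]

theorem affineMap_vertices [DecidableEq ι] (x : stdSimplex ℝ ι) :
    affineMap (stdSimplex.vertex (S := ℝ)) x = x := by
  ext c
  simp [affineMap_apply, Pi.single_apply]

theorem affineMap_vertex_comp [DecidableEq κ] (f : ι → κ) (x : stdSimplex ℝ ι) :
    affineMap (stdSimplex.vertex ∘ f) x = stdSimplex.map f x := by
  classical
  ext c
  rw [affineMap_apply, stdSimplex.map_coe, FunOnFinite.linearMap_apply_apply]
  simp [Pi.single_apply, Finset.sum_filter, eq_comm]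

theorem continuous_affineMap (v : ι → stdSimplex ℝ κ) : Continuous (affineMap v) := by
  refine Continuous.subtype_mk (continuous_pi fun c => continuous_finsetSum _ fun i _ => ?_) _
  exact ((continuous_apply i).comp continuous_subtype_val).mul continuous_const

theorem dist_affineMap_le {v : ι → stdSimplex ℝ κ} {p : stdSimplex ℝ κ} {r : ℝ} (hr : 0 ≤ r)
    (h : ∀ i, dist (v i) p ≤ r) (x : stdSimplex ℝ ι) : dist (affineMap v x) p ≤ r := by
  refine (dist_pi_le_iff hr).2 fun c => ?_
  have hp : p c = ∑ i, x i * p c := by rw [← Finset.sum_mul, stdSimplex.sum_eq_one, one_mul]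
  change dist (affineMap v x c) (p c) ≤ r
  rw [hp, affineMap_apply, Real.dist_eq, ← Finset.sum_sub_distrib]
  calc |∑ i, (x i * v i c - x i * p c)| ≤ ∑ i, |x i * v i c - x i * p c| :=
        Finset.abs_sum_le_sum_abs _ _
    _ ≤ ∑ i, x i * r := by
        refine Finset.sum_le_sum fun i _ => ?_
        rw [← mul_sub, abs_mul, abs_of_nonneg (stdSimplex.zero_le x i)]
        refine mul_le_mul_of_nonneg_left ?_ (stdSimplex.zero_le x i)
        exact (dist_le_pi_dist (v i).1 p.1 c).trans (h i)
    _ = r := by rw [← Finset.sum_mul, stdSimplex.sum_eq_one, one_mul]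

/-- The barycentre of a nonempty tuple of points of a standard simplex. -/
def center (n : ℕ) (v : Fin (n + 1) → stdSimplex ℝ κ) : stdSimplex ℝ κ :=
  affineMap v stdSimplex.barycenter

theorem affineMap_center (w : κ → stdSimplex ℝ μ) (n : ℕ) (v : Fin (n + 1) → stdSimplex ℝ κ) :
    affineMap w (center n v) = center n (affineMap w ∘ v) :=
  affineMap_affineMap _ _ _

/-- The barycentre of `n + 1` points with mutual distances at most `D` is at distance at most
`n / (n + 1) * D` from each of them: the point itself does not contribute to the mean distance. -/
theorem dist_center_le {n : ℕ} {v : Fin (n + 1) → stdSimplex ℝ κ} {D : ℝ}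
    (h : ∀ i j, dist (v i) (v j) ≤ D) (i : Fin (n + 1)) :
    dist (v i) (center n v) ≤ n / (n + 1) * D := by
  have hD : 0 ≤ D := dist_nonneg.trans (h i i)
  rw [dist_comm]
  refine (dist_pi_le_iff (by positivity)).2 fun c => ?_
  have hn : (n + 1 : ℝ) ≠ 0 := by positivity
  have hb : ∀ j, (stdSimplex.barycenter : stdSimplex ℝ (Fin (n + 1))) j = (n + 1 : ℝ)⁻¹ := by
    intro j
    refine (stdSimplex.barycenter_apply j).trans ?_
    simp
  have hp : v i c = ∑ j : Fin (n + 1), (n + 1 : ℝ)⁻¹ * v i c := by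
    simp only [Finset.sum_const, Finset.card_univ, Fintype.card_fin, nsmul_eq_mul]
    push_cast
    field_simp
  change dist (center n v c) (v i c) ≤ _
  rw [center, affineMap_apply, hp, Real.dist_eq, ← Finset.sum_sub_distrib]
  calc |∑ j, ((stdSimplex.barycenter : stdSimplex ℝ (Fin (n + 1))) j * v j c -
          (n + 1 : ℝ)⁻¹ * v i c)|
      ≤ ∑ j, |(stdSimplex.barycenter : stdSimplex ℝ (Fin (n + 1))) j * v j c -
          (n + 1 : ℝ)⁻¹ * v i c| := Finset.abs_sum_le_sum_abs _ _
    _ ≤ ∑ j, (n + 1 : ℝ)⁻¹ * (D - if j = i then D else 0) := by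
        refine Finset.sum_le_sum fun j _ => ?_
        rw [hb, ← mul_sub, abs_mul, abs_of_nonneg (by positivity)]
        refine mul_le_mul_of_nonneg_left ?_ (by positivity)
        split_ifs with hj
        · simp [hj]
        · rw [sub_zero]
          exact (dist_le_pi_dist (v j).1 (v i).1 c).trans (h j i)
    _ = n / (n + 1) * D := by
        rw [← Finset.mul_sum, Finset.sum_sub_distrib]
        simp only [Finset.sum_const, Finset.card_univ, Fintype.card_fin, nsmul_eq_mul,
          Finset.sum_ite_eq', Finset.mem_univ, if_true]
        push_cast
        field_simp
        ring

end Affine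

namespace TupleChain

variable {k : Type w} [Field k] {κ : Type v} [Fintype κ]

theorem lift_mem {P : Type v} {n : ℕ} {M : Type*} [AddCommGroup M] [Module k M]
    (f : (Fin n → P) → M) {s : Set (Fin n → P)} {N : Submodule k M} (h : ∀ v ∈ s, f v ∈ N)
    {c : TupleChain k P n} (hc : c ∈ Finsupp.supported k k s) : lift k f c ∈ N := by
  rw [Finsupp.linearCombination_apply]
  exact Submodule.sum_mem _ fun v hv => N.smul_mem _ (h v (hc hv))

theorem of_mem_supported {P : Type v} {n : ℕ} {s : Set (Fin n → P)} {v : Fin n → P} (h : v ∈ s) :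
    of k v ∈ Finsupp.supported k k s :=
  Finsupp.single_mem_supported k 1 h

/-- The tuples of points in the convex hull of `v` with mutual distances at most `r`. -/
def subtuples {m n : ℕ} (v : Fin m → stdSimplex ℝ κ) (r : ℝ) : Set (Fin n → stdSimplex ℝ κ) :=
  {w | (∀ j, w j ∈ Set.range (affineMap v)) ∧ ∀ i j, dist (w i) (w j) ≤ r}

/-- The subdivision of a tuple of diameter at most `D` with at most `N + 1` members has members of
diameter at most `N / (N + 1) * D`. -/
theorem subdivision_mem_supported (N : ℕ) {D : ℝ} (n : ℕ) (hn : n ≤ N + 1)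
    (v : Fin n → stdSimplex ℝ κ) (h : ∀ i j, dist (v i) (v j) ≤ D) :
    subdivision k center n (of k v) ∈ Finsupp.supported k k (subtuples v (N / (N + 1) * D)) := by
  induction n with
  | zero => exact of_mem_supported ⟨fun j => j.elim0, fun j => j.elim0⟩
  | succ n ih =>
    have hD : 0 ≤ D := dist_nonneg.trans (h 0 0)
    have hnN : (n / (n + 1) * D : ℝ) ≤ N / (N + 1) * D := by
      have : (n : ℝ) ≤ N := by exact_mod_cast Nat.le_of_succ_le_succ hn
      refine mul_le_mul_of_nonneg_right ?_ hD
      rw [div_le_div_iff₀ (by positivity) (by positivity)]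
      linarith
    have hr : (0 : ℝ) ≤ N / (N + 1) * D := by positivity
    rw [subdivision_of, boundary_of, map_sum, map_sum]
    refine Submodule.sum_mem _ fun i _ => ?_
    rw [map_smul, map_smul]
    refine Submodule.smul_mem _ _ (lift_mem _ ?_ (ih (by lia) (v ∘ i.succAbove)
      fun a b => h _ _))
    rintro w ⟨hw, hd⟩
    -- `w` comes from the face opposite to the `i`-th vertex, whose hull lies in that of `v`.
    have hw' : ∀ j, w j ∈ Set.range (affineMap v) := by
      intro j
      obtain ⟨x, hx⟩ := hw j
      refine ⟨affineMap (stdSimplex.vertex ∘ i.succAbove) x, ?_⟩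
      rw [affineMap_affineMap, ← hx]
      congr 1
      funext a
      exact affineMap_vertex _ _
    have hc : ∀ j, dist (w j) (center n v) ≤ N / (N + 1) * D := by
      intro j
      obtain ⟨x, hx⟩ := hw' j
      rw [← hx]
      exact dist_affineMap_le hr (fun a => (dist_center_le h a).trans hnN) x
    refine of_mem_supported ⟨fun j => ?_, fun a b => ?_⟩
    · refine Fin.cases ?_ (fun j => ?_) j
      · exact ⟨_, rfl⟩
      · exact hw' j
    · refine Fin.cases ?_ (fun a => ?_) a <;> refine Fin.cases ?_ (fun b => ?_) b
      · simpa using hr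
      · simpa [dist_comm] using hc b
      · simpa using hc a
      · simpa using hd a b

/-- Iterated barycentric subdivision makes the members of a chain arbitrarily small. -/
theorem iterate_subdivision_mem_supported (n : ℕ) {D : ℝ} (v : Fin (n + 1) → stdSimplex ℝ κ)
    (h : ∀ i j, dist (v i) (v j) ≤ D) (m : ℕ) :
    (subdivision k center (n + 1))^[m] (of k v) ∈
      Finsupp.supported k k {w | ∀ i j, dist (w i) (w j) ≤ ((n / (n + 1) : ℝ)) ^ m * D} := by
  induction m with
  | zero => exact of_mem_supported (by simpa using h)
  | succ m ih =>
    rw [Function.iterate_succ_apply']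
    have h : subdivision k center (n + 1) =
        lift k fun w : Fin (n + 1) → stdSimplex ℝ κ => subdivision k center (n + 1) (of k w) :=
      hom_ext fun w => by rw [lift_of]
    refine LinearMap.congr_fun h _ ▸ lift_mem _ (fun w hw => ?_) ih
    refine Finsupp.supported_mono ?_ (subdivision_mem_supported n (n + 1) le_rfl w hw)
    rintro x ⟨-, hx⟩ i j
    refine (hx i j).trans_eq ?_
    rw [pow_succ]
    ring

end TupleChain

/-! ### The basis of singular simplices -/

section SingularChains

open scoped Simplicial

variable {k : Type w} [Field k] {X Y : TopCat.{u}} {n : ℕ}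

/-- The basis element of the singular chains given by a singular simplex. -/
def singularSimplex (σ : C(stdSimplex ℝ (Fin (n + 1)), X)) : ((singularChains.{u} k).obj X).X n :=
  ((TopCat.toSSet.obj X).ιChainComplex (R := coeff.{u} k)
    ((X.toSSetObjEquiv (Opposite.op ⦋n⦌)).symm σ)).hom ⟨1⟩

/-- The linear map on singular chains with prescribed values on singular simplices. -/
def singularLift {M : Type max w u} [AddCommGroup M] [Module k M]
    (f : C(stdSimplex ℝ (Fin (n + 1)), X) → M) : ((singularChains.{u} k).obj X).X n →ₗ[k] M :=
  (Cofan.IsColimit.desc ((TopCat.toSSet.obj X).isColimitChainComplexXCofan (coeff.{u} k) n)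
    (fun x => ModuleCat.ofHom ((LinearMap.toSpanSingleton k M
      (f (X.toSSetObjEquiv (Opposite.op ⦋n⦌) x))).comp ULift.moduleEquiv.toLinearMap)) :
      ((singularChains.{u} k).obj X).X n ⟶ ModuleCat.of k M).hom

theorem singularLift_singularSimplex {M : Type max w u} [AddCommGroup M] [Module k M]
    (f : C(stdSimplex ℝ (Fin (n + 1)), X) → M) (σ : C(stdSimplex ℝ (Fin (n + 1)), X)) :
    singularLift (k := k) f (singularSimplex σ) = f σ := by
  have h := Cofan.IsColimit.fac
    ((TopCat.toSSet.obj X).isColimitChainComplexXCofan (coeff.{u} k) n)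
    (fun x => ModuleCat.ofHom ((LinearMap.toSpanSingleton k M
      (f (X.toSSetObjEquiv (Opposite.op ⦋n⦌) x))).comp ULift.moduleEquiv.toLinearMap))
    ((X.toSSetObjEquiv (Opposite.op ⦋n⦌)).symm σ)
  refine (LinearMap.congr_fun (congrArg ModuleCat.Hom.hom h) ⟨1⟩).trans ?_
  simp

theorem singularChains_hom_ext {M : Type max w u} [AddCommGroup M] [Module k M]
    {f g : ((singularChains.{u} k).obj X).X n →ₗ[k] M}
    (h : ∀ σ, f (singularSimplex σ) = g (singularSimplex σ)) : f = g := by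
  have : ModuleCat.ofHom f = ModuleCat.ofHom g := by
    refine SSet.chainComplex_hom_ext fun x => ModuleCat.hom_ext ?_
    refine LinearMap.ext fun c => ?_
    have hc : c = c.down • (⟨1⟩ : ULift.{u} k) := by
      ext
      simp
    have hx := h (X.toSSetObjEquiv (Opposite.op ⦋n⦌) x)
    rw [singularSimplex, Equiv.symm_apply_apply] at hx
    rw [hc, map_smul, map_smul]
    exact congrArg _ hx
  exact congrArg ModuleCat.Hom.hom this

/-- A submodule that contains the singular simplices contains all singular chains. -/
theorem mem_of_singularSimplex_mem {N : Submodule k (((singularChains.{u} k).obj X).X n)}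
    (h : ∀ σ, singularSimplex σ ∈ N) (c : ((singularChains.{u} k).obj X).X n) : c ∈ N := by
  have : N.mkQ = 0 := singularChains_hom_ext fun σ => by
    simpa using h σ
  rw [← N.ker_mkQ, this]
  trivial

theorem map_singularSimplex (f : X ⟶ Y) (σ : C(stdSimplex ℝ (Fin (n + 1)), X)) :
    (((singularChains.{u} k).map f).f n).hom (singularSimplex σ) =
      singularSimplex (f.hom.comp σ) := by
  have h := SSet.ι_chainComplexMap_f _ _ (TopCat.toSSet.map f) (coeff.{u} k)
    ((X.toSSetObjEquiv (Opposite.op ⦋n⦌)).symm σ)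
  exact LinearMap.congr_fun (congrArg ModuleCat.Hom.hom h) ⟨1⟩

/-- The affine map between standard simplices as a continuous map. -/
def affineContinuousMap {ι κ : Type*} [Fintype ι] [Fintype κ] (v : ι → stdSimplex ℝ κ) :
    C(stdSimplex ℝ ι, stdSimplex ℝ κ) :=
  ⟨affineMap v, continuous_affineMap v⟩

theorem d_singularSimplex (σ : C(stdSimplex ℝ (Fin (n + 2)), X)) :
    (((singularChains.{u} k).obj X).d (n + 1) n).hom (singularSimplex σ) =
      ∑ i : Fin (n + 2), (-1 : k) ^ (i : ℕ) •
        singularSimplex (σ.comp (affineContinuousMap (stdSimplex.vertex ∘ i.succAbove))) := by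
  have h := SSet.ιChainComplex_d (TopCat.toSSet.obj X) (coeff.{u} k)
    ((X.toSSetObjEquiv (Opposite.op ⦋n + 1⦌)).symm σ)
  refine (LinearMap.congr_fun (congrArg ModuleCat.Hom.hom h) ⟨1⟩).trans ?_
  rw [ModuleCat.hom_sum, LinearMap.sum_apply]
  refine Finset.sum_congr rfl fun i _ => ?_
  rw [ModuleCat.hom_zsmul, LinearMap.smul_apply, ← Int.cast_smul_eq_zsmul k]
  have hi : (TopCat.toSSet.obj X).δ i ((X.toSSetObjEquiv (Opposite.op ⦋n + 1⦌)).symm σ) =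
      (X.toSSetObjEquiv (Opposite.op ⦋n⦌)).symm
        (σ.comp (affineContinuousMap (stdSimplex.vertex ∘ i.succAbove))) := by
    refine (TopCat.toSSetObjEquiv_symm_naturality _ σ).trans (congrArg _ ?_)
    refine congrArg σ.comp (ContinuousMap.ext fun x => ?_)
    exact (affineMap_vertex_comp _ x).symm
  rw [hi]
  simp only [Int.cast_pow, Int.cast_neg, Int.cast_one]
  rfl

/-! ### Subdivision of singular chains -/

/-- The singular chain obtained from a chain of tuples of points of the standard simplex by
composing the affine simplices with a singular simplex `σ`. -/
def realize (k : Type w) [Field k] (σ : C(stdSimplex ℝ (Fin (n + 1)), X)) (m : ℕ) :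
    TupleChain k (stdSimplex ℝ (Fin (n + 1))) (m + 1) →ₗ[k] ((singularChains.{u} k).obj X).X m :=
  TupleChain.lift k fun v => singularSimplex (σ.comp (affineContinuousMap v))

variable (k n) in
/-- The tuple of all vertices of the standard simplex. -/
def vertexTuple : TupleChain k (stdSimplex ℝ (Fin (n + 1))) (n + 1) :=
  TupleChain.of k stdSimplex.vertex

theorem realize_of {m : ℕ} (σ : C(stdSimplex ℝ (Fin (n + 1)), X))
    (v : Fin (m + 1) → stdSimplex ℝ (Fin (n + 1))) :
    realize k σ m (TupleChain.of k v) = singularSimplex (σ.comp (affineContinuousMap v)) :=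
  TupleChain.lift_of _ v

theorem realize_vertexTuple (σ : C(stdSimplex ℝ (Fin (n + 1)), X)) :
    realize k σ n (vertexTuple k n) = singularSimplex σ := by
  rw [vertexTuple, realize_of]
  exact congrArg _ (ContinuousMap.ext fun x => congrArg σ (affineMap_vertices x))

theorem map_realize (f : X ⟶ Y) (σ : C(stdSimplex ℝ (Fin (n + 1)), X)) (m : ℕ)
    (c : TupleChain k (stdSimplex ℝ (Fin (n + 1))) (m + 1)) :
    (((singularChains.{u} k).map f).f m).hom (realize k σ m c) =
      realize k (f.hom.comp σ) m c := by
  suffices h : (((singularChains.{u} k).map f).f m).hom ∘ₗ realize k σ m =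
      realize k (f.hom.comp σ) m from LinearMap.congr_fun h c
  refine TupleChain.hom_ext fun v => ?_
  rw [LinearMap.comp_apply, realize_of, realize_of, map_singularSimplex]
  rfl

theorem d_realize (σ : C(stdSimplex ℝ (Fin (n + 1)), X)) (m : ℕ)
    (c : TupleChain k (stdSimplex ℝ (Fin (n + 1))) (m + 2)) :
    (((singularChains.{u} k).obj X).d (m + 1) m).hom (realize k σ (m + 1) c) =
      realize k σ m (TupleChain.boundary k _ (m + 1) c) := by
  suffices h : (((singularChains.{u} k).obj X).d (m + 1) m).hom ∘ₗ realize k σ (m + 1) =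
      realize k σ m ∘ₗ TupleChain.boundary k _ (m + 1) from LinearMap.congr_fun h c
  refine TupleChain.hom_ext fun v => ?_
  rw [LinearMap.comp_apply, LinearMap.comp_apply, realize_of, d_singularSimplex,
    TupleChain.boundary_of, map_sum]
  refine Finset.sum_congr rfl fun i _ => ?_
  rw [map_smul, realize_of]
  congr 2
  refine ContinuousMap.ext fun x => congrArg σ ((affineMap_affineMap _ _ x).trans ?_)
  congr 1
  funext j
  exact affineMap_vertex _ _

theorem realize_comp_affine {m l : ℕ} (σ : C(stdSimplex ℝ (Fin (n + 1)), X))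
    (v : Fin (m + 1) → stdSimplex ℝ (Fin (n + 1)))
    (c : TupleChain k (stdSimplex ℝ (Fin (m + 1))) (l + 1)) :
    realize k (σ.comp (affineContinuousMap v)) l c =
      realize k σ l (TupleChain.map k (affineMap v) (l + 1) c) := by
  suffices h : realize k (σ.comp (affineContinuousMap v)) l =
      realize k σ l ∘ₗ TupleChain.map k (affineMap v) (l + 1) from LinearMap.congr_fun h c
  refine TupleChain.hom_ext fun w => ?_
  rw [LinearMap.comp_apply, realize_of, TupleChain.map_of, realize_of]
  exact congrArg _ (ContinuousMap.ext fun x => congrArg σ (affineMap_affineMap _ _ x))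

theorem map_vertexTuple {m : ℕ} (v : Fin (m + 1) → stdSimplex ℝ (Fin (n + 1))) :
    TupleChain.map k (affineMap v) (m + 1) (vertexTuple k m) = TupleChain.of k v := by
  rw [vertexTuple, TupleChain.map_of]
  congr 1
  funext i
  exact affineMap_vertex v i

variable (k X n) in
/-- Barycentric subdivision of singular chains. -/
def singularSubdivision :
    ((singularChains.{u} k).obj X).X n →ₗ[k] ((singularChains.{u} k).obj X).X n :=
  singularLift fun σ => realize k σ n (TupleChain.subdivision k center (n + 1) (vertexTuple k n))

variable (k X n) in
/-- The natural chain homotopy from the identity to barycentric subdivision. -/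
def singularHomotopy :
    ((singularChains.{u} k).obj X).X n →ₗ[k] ((singularChains.{u} k).obj X).X (n + 1) :=
  singularLift fun σ =>
    realize k σ (n + 1) (TupleChain.homotopy k center (n + 1) (vertexTuple k n))

theorem singularSubdivision_realize (σ : C(stdSimplex ℝ (Fin (n + 1)), X)) (m : ℕ)
    (c : TupleChain k (stdSimplex ℝ (Fin (n + 1))) (m + 1)) :
    singularSubdivision k X m (realize k σ m c) =
      realize k σ m (TupleChain.subdivision k center (m + 1) c) := by
  suffices h : singularSubdivision k X m ∘ₗ realize k σ m =
      realize k σ m ∘ₗ TupleChain.subdivision k center (m + 1) from LinearMap.congr_fun h c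
  refine TupleChain.hom_ext fun v => ?_
  rw [LinearMap.comp_apply, LinearMap.comp_apply, realize_of, singularSubdivision,
    singularLift_singularSimplex, realize_comp_affine,
    TupleChain.map_subdivision _ (affineMap_center v), map_vertexTuple]

theorem singularHomotopy_realize (σ : C(stdSimplex ℝ (Fin (n + 1)), X)) (m : ℕ)
    (c : TupleChain k (stdSimplex ℝ (Fin (n + 1))) (m + 1)) :
    singularHomotopy k X m (realize k σ m c) =
      realize k σ (m + 1) (TupleChain.homotopy k center (m + 1) c) := by
  suffices h : singularHomotopy k X m ∘ₗ realize k σ m =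
      realize k σ (m + 1) ∘ₗ TupleChain.homotopy k center (m + 1) from LinearMap.congr_fun h c
  refine TupleChain.hom_ext fun v => ?_
  rw [LinearMap.comp_apply, LinearMap.comp_apply, realize_of, singularHomotopy,
    singularLift_singularSimplex, realize_comp_affine,
    TupleChain.map_homotopy _ (affineMap_center v), map_vertexTuple]

theorem map_singularSubdivision (f : X ⟶ Y) (c : ((singularChains.{u} k).obj X).X n) :
    (((singularChains.{u} k).map f).f n).hom (singularSubdivision k X n c) =
      singularSubdivision k Y n ((((singularChains.{u} k).map f).f n).hom c) := by
  suffices h : (((singularChains.{u} k).map f).f n).hom ∘ₗ singularSubdivision k X n =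
      singularSubdivision k Y n ∘ₗ (((singularChains.{u} k).map f).f n).hom from
    LinearMap.congr_fun h c
  refine singularChains_hom_ext fun σ => ?_
  rw [LinearMap.comp_apply, LinearMap.comp_apply, map_singularSimplex, singularSubdivision,
    singularSubdivision, singularLift_singularSimplex, singularLift_singularSimplex, map_realize]

theorem map_singularHomotopy (f : X ⟶ Y) (c : ((singularChains.{u} k).obj X).X n) :
    (((singularChains.{u} k).map f).f (n + 1)).hom (singularHomotopy k X n c) =
      singularHomotopy k Y n ((((singularChains.{u} k).map f).f n).hom c) := by
  suffices h : (((singularChains.{u} k).map f).f (n + 1)).hom ∘ₗ singularHomotopy k X n =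
      singularHomotopy k Y n ∘ₗ (((singularChains.{u} k).map f).f n).hom from
    LinearMap.congr_fun h c
  refine singularChains_hom_ext fun σ => ?_
  rw [LinearMap.comp_apply, LinearMap.comp_apply, map_singularSimplex, singularHomotopy,
    singularHomotopy, singularLift_singularSimplex, singularLift_singularSimplex, map_realize]

theorem d_singularHomotopy_zero (c : ((singularChains.{u} k).obj X).X 0) :
    (((singularChains.{u} k).obj X).d 1 0).hom (singularHomotopy k X 0 c) =
      c - singularSubdivision k X 0 c := by
  suffices h : (((singularChains.{u} k).obj X).d 1 0).hom ∘ₗ singularHomotopy k X 0 =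
      LinearMap.id - singularSubdivision k X 0 from LinearMap.congr_fun h c
  refine singularChains_hom_ext fun σ => ?_
  have h := TupleChain.boundary_homotopy center (vertexTuple k 0)
  rw [TupleChain.homotopy, LinearMap.zero_apply, add_zero] at h
  rw [LinearMap.comp_apply, LinearMap.sub_apply, LinearMap.id_apply, ← realize_vertexTuple σ,
    singularHomotopy_realize, singularSubdivision_realize, d_realize, h, map_sub]

theorem d_singularHomotopy_succ (c : ((singularChains.{u} k).obj X).X (n + 1)) :
    (((singularChains.{u} k).obj X).d (n + 2) (n + 1)).hom (singularHomotopy k X (n + 1) c) +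
        singularHomotopy k X n ((((singularChains.{u} k).obj X).d (n + 1) n).hom c) =
      c - singularSubdivision k X (n + 1) c := by
  suffices h : (((singularChains.{u} k).obj X).d (n + 2) (n + 1)).hom ∘ₗ
        singularHomotopy k X (n + 1) +
      singularHomotopy k X n ∘ₗ (((singularChains.{u} k).obj X).d (n + 1) n).hom =
      LinearMap.id - singularSubdivision k X (n + 1) from LinearMap.congr_fun h c
  refine singularChains_hom_ext fun σ => ?_
  have h := TupleChain.boundary_homotopy center (vertexTuple k (n + 1))
  rw [LinearMap.add_apply, LinearMap.comp_apply, LinearMap.comp_apply, LinearMap.sub_apply,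
    LinearMap.id_apply, ← realize_vertexTuple σ, singularHomotopy_realize,
    singularSubdivision_realize, d_realize, d_realize, singularHomotopy_realize, ← map_add, h,
    map_sub]

end SingularChains

/-! ### A criterion for quasi-isomorphisms -/

/-- A monomorphism of complexes is a quasi-isomorphism if every relative cycle is, up to a
boundary, in its image. -/
theorem isIso_homologyMap_of_relative_cycles {R : Type w} [Ring R]
    {K L : ChainComplex (ModuleCat.{v} R) ℕ} (φ : K ⟶ L) [Mono φ]
    (h : ∀ (n : ℕ) (z : L.X n), (∀ j, L.d n j z ∈ LinearMap.range (φ.f j).hom) →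
      ∃ w : L.X (n + 1), z - L.d (n + 1) n w ∈ LinearMap.range (φ.f n).hom) (n : ℕ) :
    IsIso (HomologicalComplex.homologyMap φ n) := by
  let S : ShortComplex (ChainComplex (ModuleCat.{v} R) ℕ) :=
    ShortComplex.mk φ (cokernel.π φ) (cokernel.condition φ)
  have hS : S.ShortExact :=
    { exact := ShortComplex.exact_cokernel φ
      mono_f := inferInstanceAs (Mono φ)
      epi_g := inferInstanceAs (Epi (cokernel.π φ)) }
  have hSn : ∀ n, (S.map (HomologicalComplex.eval _ _ n)).ShortExact := fun n =>
    hS.map_of_exact _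
  have hsurj : ∀ n, Function.Surjective (S.g.f n) := fun n =>
    (ModuleCat.epi_iff_surjective _).1 (hSn n).epi_g
  have hex : ∀ n (y : L.X n), S.g.f n y = 0 → y ∈ LinearMap.range (φ.f n).hom := fun n =>
    (ShortComplex.moduleCat_exact_iff _).1 (hSn n).exact
  have hQ : ∀ n, S.X₃.ExactAt n := by
    intro n
    rw [HomologicalComplex.exactAt_iff' S.X₃ (n + 1) n _ (by simp) rfl,
      ShortComplex.moduleCat_exact_iff]
    intro q hq
    obtain ⟨z, rfl⟩ := hsurj n q
    obtain ⟨w, s, hs⟩ := h n z fun j => by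
      by_cases hj : (ComplexShape.down ℕ).next n = j
      · subst hj
        refine hex _ _ ?_
        exact (ConcreteCategory.congr_hom (S.g.comm n _) z).symm.trans hq
      · rw [L.shape _ _ fun hr => hj (ComplexShape.next_eq' _ hr)]
        exact Submodule.zero_mem _
    refine ⟨S.g.f (n + 1) w, ?_⟩
    have h1 : S.g.f n (z - L.d (n + 1) n w) = 0 := by
      rw [← hs]
      exact ConcreteCategory.congr_hom (HomologicalComplex.congr_hom S.zero n) s
    rw [map_sub, sub_eq_zero] at h1
    exact (ConcreteCategory.congr_hom (S.g.comm (n + 1) n) w).trans h1.symm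
  have hmono : Mono (HomologicalComplex.homologyMap φ n) :=
    (hS.homology_exact₁ (n + 1) n rfl).mono_g ((hQ (n + 1)).isZero_homology.eq_of_src _ _)
  have hepi : Epi (HomologicalComplex.homologyMap φ n) :=
    (hS.homology_exact₂ n).epi_f ((hQ n).isZero_homology.eq_of_tgt _ _)
  exact isIso_of_mono_of_epi _

/-! ### Small chains -/

section SmallChains

variable {k : Type w} [Field k] {X : Type u} [TopologicalSpace X] {n : ℕ}

/-- The inclusion of open sets as a continuous map. -/
abbrev inclusion {U V : Opens X} (h : U ≤ V) :
    (Opens.toTopCat (TopCat.of X)).obj U ⟶ (Opens.toTopCat (TopCat.of X)).obj V :=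
  (Opens.toTopCat (TopCat.of X)).map (homOfLE h)

/-- A singular simplex of `V` that lies in `U`, as a singular simplex of `U`. -/
def restrictSimplex {U V : Opens X}
    (σ : C(stdSimplex ℝ (Fin (n + 1)), (Opens.toTopCat (TopCat.of X)).obj V))
    (hσ : ∀ x, (σ x).1 ∈ U) :
    C(stdSimplex ℝ (Fin (n + 1)), (Opens.toTopCat (TopCat.of X)).obj U) :=
  ⟨fun x => ⟨(σ x).1, hσ x⟩,
    (continuous_subtype_val.comp σ.continuous).subtype_mk hσ⟩

open Classical in
variable (k) in
/-- The projection from the chains of `V` to the chains of `U` that is the identity on the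
simplices of `U` and kills the other simplices. It does not commute with the differentials. -/
def chainsProjection (U V : Opens X) (n : ℕ) :
    (chains.{u} k V).X n →ₗ[k] (chains.{u} k U).X n :=
  singularLift fun σ =>
    if hσ : ∀ x, (σ x).1 ∈ U then singularSimplex (restrictSimplex σ hσ) else 0

theorem chainsProjection_chainsMap {U V : Opens X} (h : U ≤ V) (c : (chains.{u} k U).X n) :
    chainsProjection k U V n ((chainsMap.{u} k h).f n c) = c := by
  suffices H : chainsProjection k U V n ∘ₗ ((chainsMap.{u} k h).f n).hom = LinearMap.id from
    LinearMap.congr_fun H c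
  refine singularChains_hom_ext fun σ => ?_
  rw [LinearMap.comp_apply, map_singularSimplex, chainsProjection, singularLift_singularSimplex]
  exact dif_pos fun x => (σ x).2

theorem chainsProjection_chainsMap_inf {U V W : Opens X} (hU : U ≤ W)
    (c : (chains.{u} k U).X n) :
    chainsProjection k V W n ((chainsMap.{u} k hU).f n c) =
      (chainsMap.{u} k (inf_le_right : U ⊓ V ≤ V)).f n (chainsProjection k (U ⊓ V) U n c) := by
  suffices H : chainsProjection k V W n ∘ₗ ((chainsMap.{u} k hU).f n).hom =
      ((chainsMap.{u} k (inf_le_right : U ⊓ V ≤ V)).f n).hom ∘ₗ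
        chainsProjection k (U ⊓ V) U n from LinearMap.congr_fun H c
  refine singularChains_hom_ext fun σ => ?_
  rw [LinearMap.comp_apply, LinearMap.comp_apply, map_singularSimplex, chainsProjection,
    chainsProjection, singularLift_singularSimplex, singularLift_singularSimplex]
  by_cases hσ : ∀ x, (σ x).1 ∈ V
  · have hσ' : ∀ x, (σ x).1 ∈ U ⊓ V := fun x => ⟨(σ x).2, hσ x⟩
    rw [dif_pos hσ', map_singularSimplex]
    exact dif_pos hσ
  · have hσ' : ¬ ∀ x, (σ x).1 ∈ U ⊓ V := fun h => hσ fun x => (h x).2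
    rw [dif_neg hσ', map_zero]
    exact dif_neg hσ

theorem chainsMap_comp {U V W : Opens X} (h : U ≤ V) (h' : V ≤ W) :
    chainsMap.{u} k h ≫ chainsMap.{u} k h' = chainsMap.{u} k (h.trans h') :=
  ((singularChains.{u} k).map_comp _ _).symm.trans
    (congrArg _ ((Opens.toTopCat (TopCat.of X)).map_comp _ _).symm)

theorem chainsMap_comp_apply {U V W : Opens X} (h : U ≤ V) (h' : V ≤ W)
    (c : (chains.{u} k U).X n) :
    (chainsMap.{u} k h').f n ((chainsMap.{u} k h).f n c) =
      (chainsMap.{u} k (h.trans h')).f n c := by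
  rw [← chainsMap_comp h h']
  rfl

/-- Chains of `U` and `V` with zero sum come from `U ∩ V`. -/
theorem exists_chains_inf_of_add_eq_zero {U V : Opens X} (a : (chains.{u} k U).X n)
    (b : (chains.{u} k V).X n)
    (h : (chainsMap.{u} k (le_sup_left : U ≤ U ⊔ V)).f n a +
      (chainsMap.{u} k (le_sup_right : V ≤ U ⊔ V)).f n b = 0) :
    ∃ c : (chains.{u} k (U ⊓ V)).X n, (chainsMap.{u} k inf_le_left).f n c = a ∧
      -(chainsMap.{u} k inf_le_right).f n c = b := by
  have hb : -(chainsMap.{u} k inf_le_right).f n (chainsProjection k (U ⊓ V) U n a) = b := by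
    rw [← chainsProjection_chainsMap_inf (le_sup_left : U ≤ U ⊔ V), eq_neg_of_add_eq_zero_left h,
      map_neg, neg_neg, chainsProjection_chainsMap]
  refine ⟨chainsProjection k (U ⊓ V) U n a, ?_, hb⟩
  refine Function.LeftInverse.injective
    (chainsProjection_chainsMap (le_sup_left : U ≤ U ⊔ V)) ?_
  rw [eq_neg_of_add_eq_zero_left h, ← hb, map_neg, neg_neg, chainsMap_comp_apply,
    chainsMap_comp_apply]

theorem chainsSum_f_apply {U V : Opens X} (y : (chains.{u} k U ⊞ chains.{u} k V).X n) :
    (chainsSum.{u} k U V).f n y =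
      (chainsMap.{u} k le_sup_left).f n
        ((biprod.fst : chains.{u} k U ⊞ chains.{u} k V ⟶ _).f n y) +
      (chainsMap.{u} k le_sup_right).f n
        ((biprod.snd : chains.{u} k U ⊞ chains.{u} k V ⟶ _).f n y) := by
  rw [chainsSum, biprod.desc_eq]
  rfl

theorem cokernel_π_smallChainsMap (U V : Opens X) :
    cokernel.π (chainsDiff.{u} k U V) ≫ smallChainsMap.{u} k U V = chainsSum.{u} k U V :=
  cokernel.π_desc _ _ _

theorem cokernel_π_f_surjective (U V : Opens X) (n : ℕ) :
    Function.Surjective ((cokernel.π (chainsDiff.{u} k U V)).f n) :=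
  (ModuleCat.epi_iff_surjective _).1 inferInstance

/-- Chains of `U` and `V` with zero sum in `U ∪ V` come from `U ∩ V`, so the quotient by the chains
of `U ∩ V` embeds into the chains of `U ∪ V`. -/
instance (U V : Opens X) : Mono (smallChainsMap.{u} k U V) := by
  refine HomologicalComplex.mono_of_mono_f _ fun n => ?_
  rw [ModuleCat.mono_iff_injective]
  refine (injective_iff_map_eq_zero ((smallChainsMap.{u} k U V).f n).hom).2 fun x hx => ?_
  obtain ⟨y, rfl⟩ := cokernel_π_f_surjective U V n x
  have h1 := (ConcreteCategory.congr_hom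
    (HomologicalComplex.congr_hom (cokernel_π_smallChainsMap.{u} (k := k) U V) n) y).symm.trans hx
  rw [chainsSum_f_apply] at h1
  obtain ⟨c, hc, hc'⟩ := exists_chains_inf_of_add_eq_zero _ _ h1
  have hy : (chainsDiff.{u} k U V).f n c = y := by
    have ht := ConcreteCategory.congr_hom (HomologicalComplex.congr_hom
      (biprod.total (X := chains.{u} k U) (Y := chains.{u} k V)) n) y
    refine Eq.trans ?_ ht
    rw [chainsDiff, biprod.lift_eq]
    change (biprod.inl : chains.{u} k U ⟶ chains.{u} k U ⊞ chains.{u} k V).f n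
        ((chainsMap.{u} k inf_le_left).f n c) +
      (biprod.inr : chains.{u} k V ⟶ chains.{u} k U ⊞ chains.{u} k V).f n
        (-(chainsMap.{u} k inf_le_right).f n c) = _
    rw [hc, hc']
    rfl
  rw [← hy]
  exact ConcreteCategory.congr_hom
    (HomologicalComplex.congr_hom (cokernel.condition (chainsDiff.{u} k U V)) n) c

variable (k) in
/-- The chains of `U ∪ V` that are sums of chains of `U` and of `V`. -/
def smallChains (U V : Opens X) (n : ℕ) : Submodule k ((chains.{u} k (U ⊔ V)).X n) :=
  LinearMap.range ((chainsMap.{u} k (le_sup_left : U ≤ U ⊔ V)).f n).hom ⊔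
    LinearMap.range ((chainsMap.{u} k (le_sup_right : V ≤ U ⊔ V)).f n).hom

theorem range_smallChainsMap (U V : Opens X) (n : ℕ) :
    LinearMap.range ((smallChainsMap.{u} k U V).f n).hom = smallChains.{u} k U V n := by
  have h := HomologicalComplex.congr_hom (cokernel_π_smallChainsMap.{u} (k := k) U V) n
  refine le_antisymm ?_ (sup_le ?_ ?_)
  · rintro _ ⟨x, rfl⟩
    obtain ⟨y, rfl⟩ := cokernel_π_f_surjective U V n x
    have hy := (ConcreteCategory.congr_hom h y).trans (chainsSum_f_apply y)
    exact hy ▸ Submodule.add_mem_sup ⟨_, rfl⟩ ⟨_, rfl⟩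
  · rintro _ ⟨a, rfl⟩
    refine ⟨(cokernel.π (chainsDiff.{u} k U V)).f n ((biprod.inl :
      chains.{u} k U ⟶ chains.{u} k U ⊞ chains.{u} k V).f n a), ?_⟩
    refine (ConcreteCategory.congr_hom h _).trans ?_
    exact ConcreteCategory.congr_hom
      (HomologicalComplex.congr_hom (biprod.inl_desc (chainsMap.{u} k (le_sup_left : U ≤ U ⊔ V))
        (chainsMap.{u} k (le_sup_right : V ≤ U ⊔ V))) n) a
  · rintro _ ⟨b, rfl⟩
    refine ⟨(cokernel.π (chainsDiff.{u} k U V)).f n ((biprod.inr :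
      chains.{u} k V ⟶ chains.{u} k U ⊞ chains.{u} k V).f n b), ?_⟩
    refine (ConcreteCategory.congr_hom h _).trans ?_
    exact ConcreteCategory.congr_hom
      (HomologicalComplex.congr_hom (biprod.inr_desc (chainsMap.{u} k (le_sup_left : U ≤ U ⊔ V))
        (chainsMap.{u} k (le_sup_right : V ≤ U ⊔ V))) n) b

/-! ### The theorem on small chains -/

theorem singularSimplex_mem_range {U W : Opens X} (h : U ≤ W)
    (σ : C(stdSimplex ℝ (Fin (n + 1)), (Opens.toTopCat (TopCat.of X)).obj W))
    (hσ : ∀ x, (σ x).1 ∈ U) :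
    singularSimplex σ ∈ LinearMap.range ((chainsMap.{u} k h).f n).hom :=
  ⟨singularSimplex (restrictSimplex σ hσ), map_singularSimplex _ _⟩

variable {U V : Opens X}

theorem map_mem_of_mem_smallChains {M : Type*} [AddCommGroup M] [Module k M]
    (f : (chains.{u} k (U ⊔ V)).X n →ₗ[k] M) {N : Submodule k M}
    (hU : ∀ a, f ((chainsMap.{u} k (le_sup_left : U ≤ U ⊔ V)).f n a) ∈ N)
    (hV : ∀ b, f ((chainsMap.{u} k (le_sup_right : V ≤ U ⊔ V)).f n b) ∈ N)
    {c : (chains.{u} k (U ⊔ V)).X n} (hc : c ∈ smallChains.{u} k U V n) : f c ∈ N := by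
  obtain ⟨_, ⟨a, rfl⟩, _, ⟨b, rfl⟩, rfl⟩ := Submodule.mem_sup.1 hc
  rw [map_add]
  exact N.add_mem (hU a) (hV b)

theorem d_mem_smallChains {c : (chains.{u} k (U ⊔ V)).X n} (hc : c ∈ smallChains.{u} k U V n)
    (j : ℕ) : (chains.{u} k (U ⊔ V)).d n j c ∈ smallChains.{u} k U V j :=
  map_mem_of_mem_smallChains ((chains.{u} k (U ⊔ V)).d n j).hom
    (N := smallChains.{u} k U V j)
    (fun a => Submodule.mem_sup_left ⟨(chains.{u} k U).d n j a, (ConcreteCategory.congr_hom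
      ((chainsMap.{u} k (le_sup_left : U ≤ U ⊔ V)).comm n j) a).symm⟩)
    (fun b => Submodule.mem_sup_right ⟨(chains.{u} k V).d n j b, (ConcreteCategory.congr_hom
      ((chainsMap.{u} k (le_sup_right : V ≤ U ⊔ V)).comm n j) b).symm⟩) hc

theorem singularSubdivision_mem_smallChains {c : (chains.{u} k (U ⊔ V)).X n}
    (hc : c ∈ smallChains.{u} k U V n) :
    singularSubdivision k _ n c ∈ smallChains.{u} k U V n :=
  map_mem_of_mem_smallChains (singularSubdivision k _ n) (N := smallChains.{u} k U V n)
    (fun a => Submodule.mem_sup_left ⟨singularSubdivision k _ n a, map_singularSubdivision _ a⟩)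
    (fun b => Submodule.mem_sup_right ⟨singularSubdivision k _ n b, map_singularSubdivision _ b⟩)
    hc

theorem singularHomotopy_mem_smallChains {c : (chains.{u} k (U ⊔ V)).X n}
    (hc : c ∈ smallChains.{u} k U V n) :
    singularHomotopy k _ n c ∈ smallChains.{u} k U V (n + 1) :=
  map_mem_of_mem_smallChains (singularHomotopy k _ n) (N := smallChains.{u} k U V (n + 1))
    (fun a => Submodule.mem_sup_left ⟨singularHomotopy k _ n a, map_singularHomotopy _ a⟩)
    (fun b => Submodule.mem_sup_right ⟨singularHomotopy k _ n b, map_singularHomotopy _ b⟩) hc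

theorem iterate_singularSubdivision_mem_smallChains {c : (chains.{u} k (U ⊔ V)).X n} {m l : ℕ}
    (h : (singularSubdivision k _ n)^[m] c ∈ smallChains.{u} k U V n) (hml : m ≤ l) :
    (singularSubdivision k _ n)^[l] c ∈ smallChains.{u} k U V n := by
  induction l, hml using Nat.le_induction with
  | base => exact h
  | succ l _ ih =>
    rw [Function.iterate_succ_apply']
    exact singularSubdivision_mem_smallChains ih

theorem iterate_singularSubdivision_singularSimplex {Y : TopCat.{u}}
    (σ : C(stdSimplex ℝ (Fin (n + 1)), Y)) (m : ℕ) :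
    (singularSubdivision k Y n)^[m] (singularSimplex σ) =
      realize k σ n ((TupleChain.subdivision k center (n + 1))^[m] (vertexTuple k n)) := by
  induction m with
  | zero => exact (realize_vertexTuple σ).symm
  | succ m ih =>
    rw [Function.iterate_succ_apply', Function.iterate_succ_apply', ih,
      singularSubdivision_realize]

/-- By Lebesgue's number lemma, iterated subdivision makes a singular simplex small. -/
theorem exists_iterate_singularSimplex_mem_smallChains
    (σ : C(stdSimplex ℝ (Fin (n + 1)), (Opens.toTopCat (TopCat.of X)).obj (U ⊔ V))) :
    ∃ m, (singularSubdivision k _ n)^[m] (singularSimplex σ) ∈ smallChains.{u} k U V n := by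
  have hval : Continuous fun x => (σ x).1 := continuous_subtype_val.comp σ.continuous
  obtain ⟨δ, hδ, hball⟩ := lebesgue_number_lemma_of_metric
    (c := fun b : Bool => {x | (σ x).1 ∈ if b then U else V}) isCompact_univ
    (fun b => by cases b <;> exact (Opens.isOpen _).preimage hval)
    (fun x _ => Set.mem_iUnion.2 <| (σ x).2.elim (fun h => ⟨true, h⟩) fun h => ⟨false, h⟩)
  have hlt : (n / (n + 1) : ℝ) < 1 := by
    rw [div_lt_one (by positivity)]
    linarith
  obtain ⟨m, hm⟩ := exists_pow_lt_of_lt_one hδ hlt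
  refine ⟨m, ?_⟩
  rw [iterate_singularSubdivision_singularSimplex]
  refine TupleChain.lift_mem _ (fun w hw => ?_)
    (TupleChain.iterate_subdivision_mem_supported n (D := 1) stdSimplex.vertex
      (fun i j => (Metric.dist_le_diam_of_mem (bounded_stdSimplex _) (Subtype.prop _)
        (Subtype.prop _)).trans diam_stdSimplex_le) m)
  have hw' : ∀ x, affineMap w x ∈ Metric.ball (w 0) δ := fun x =>
    (dist_affineMap_le (dist_nonneg.trans (hw 0 0)) (fun i => hw i 0) x).trans_lt
      (by rwa [mul_one])
  obtain ⟨b, hb⟩ := hball (w 0) (Set.mem_univ _)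
  cases b
  · exact Submodule.mem_sup_right (singularSimplex_mem_range _ _ fun x => hb (hw' x))
  · exact Submodule.mem_sup_left (singularSimplex_mem_range _ _ fun x => hb (hw' x))

theorem exists_iterate_mem_smallChains (c : (chains.{u} k (U ⊔ V)).X n) :
    ∃ m, (singularSubdivision k _ n)^[m] c ∈ smallChains.{u} k U V n := by
  let N : Submodule k ((chains.{u} k (U ⊔ V)).X n) :=
    { carrier := {c | ∃ m, (singularSubdivision k _ n)^[m] c ∈ smallChains.{u} k U V n}
      zero_mem' := ⟨0, Submodule.zero_mem _⟩
      add_mem' := by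
        rintro a b ⟨m, hm⟩ ⟨l, hl⟩
        refine ⟨max m l, ?_⟩
        rw [iterate_map_add]
        exact Submodule.add_mem _
          (iterate_singularSubdivision_mem_smallChains hm (le_max_left _ _))
          (iterate_singularSubdivision_mem_smallChains hl (le_max_right _ _))
      smul_mem' := by
        rintro r a ⟨m, hm⟩
        refine ⟨m, ?_⟩
        rw [← Module.End.pow_apply, map_smul, Module.End.pow_apply]
        exact Submodule.smul_mem _ _ hm }
  exact mem_of_singularSimplex_mem (N := N) exists_iterate_singularSimplex_mem_smallChains c

/-- One subdivision changes a relative cycle by a boundary and a small chain. -/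
theorem exists_sub_d_sub_singularSubdivision_mem (z : (chains.{u} k (U ⊔ V)).X n)
    (hz : ∀ j, (chains.{u} k (U ⊔ V)).d n j z ∈ smallChains.{u} k U V j) :
    z - (chains.{u} k (U ⊔ V)).d (n + 1) n (singularHomotopy k _ n z) -
      singularSubdivision k _ n z ∈ smallChains.{u} k U V n := by
  cases n with
  | zero =>
    have h := d_singularHomotopy_zero (k := k) z
    convert Submodule.zero_mem (smallChains.{u} k U V 0) using 1
    refine (congrArg (fun t => z - t - _) h).trans ?_
    abel
  | succ n =>
    have h := d_singularHomotopy_succ (k := k) z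
    convert singularHomotopy_mem_smallChains (hz n) using 1
    rw [sub_right_comm, sub_eq_iff_eq_add', ← h]

/-- A relative cycle of `(U ∪ V, small chains)` is small up to a boundary. -/
theorem exists_sub_d_mem_smallChains (z : (chains.{u} k (U ⊔ V)).X n)
    (hz : ∀ j, (chains.{u} k (U ⊔ V)).d n j z ∈ smallChains.{u} k U V j) :
    ∃ w, z - (chains.{u} k (U ⊔ V)).d (n + 1) n w ∈ smallChains.{u} k U V n := by
  obtain ⟨m, hm⟩ := exists_iterate_mem_smallChains z
  induction m generalizing z with
  | zero => exact ⟨0, by simpa using hm⟩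
  | succ m ih =>
    have h1 := exists_sub_d_sub_singularSubdivision_mem z hz
    have h2 : ∀ j, (chains.{u} k (U ⊔ V)).d n j (singularSubdivision k _ n z) ∈
        smallChains.{u} k U V j := by
      intro j
      have h3 := d_mem_smallChains h1 j
      have h4 : (chains.{u} k (U ⊔ V)).d n j ((chains.{u} k (U ⊔ V)).d (n + 1) n
          (singularHomotopy k _ n z)) = 0 :=
        ConcreteCategory.congr_hom ((chains.{u} k (U ⊔ V)).d_comp_d (n + 1) n j) _
      rw [map_sub, map_sub, h4, sub_zero] at h3
      exact (Submodule.sub_mem_iff_right _ (hz j)).1 h3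
    obtain ⟨w, hw⟩ := ih (singularSubdivision k _ n z) h2 hm
    refine ⟨singularHomotopy k _ n z + w, ?_⟩
    convert Submodule.add_mem _ h1 hw using 1
    rw [map_add]
    abel

/-- The complex of small chains computes the singular homology of `U ∪ V`. -/
instance isIso_smallHomologyMap (U V : Opens X) (n : ℕ) :
    IsIso (smallHomologyMap.{u} k U V n) := by
  refine isIso_homologyMap_of_relative_cycles (smallChainsMap.{u} k U V) (fun n z hz => ?_) n
  simp only [range_smallChainsMap] at hz ⊢
  exact exists_sub_d_mem_smallChains z hz

end SmallChains

/-! ### The Mayer-Vietoris sequence -/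

section MayerVietorisSequence

variable {k : Type w} [Field k] {X : Type u} [TopologicalSpace X]

variable (k) in
/-- The map `H_n(U) → H_n(V)` induced by an inclusion `U ⊆ V`. -/
abbrev homologyRes {U V : Opens X} (h : U ≤ V) (n : ℕ) :
    (homologyOpens.{u} k X n).obj U ⟶ (homologyOpens.{u} k X n).obj V :=
  (homologyOpens.{u} k X n).map (homOfLE h)

theorem homologyRes_comp {U V W : Opens X} (h : U ≤ V) (h' : V ≤ W) (n : ℕ) :
    homologyRes.{u} k h n ≫ homologyRes.{u} k h' n = homologyRes.{u} k (h.trans h') n :=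
  ((homologyOpens.{u} k X n).map_comp _ _).symm

theorem homologyRes_self {U : Opens X} (h : U ≤ U) (n : ℕ) : homologyRes.{u} k h n = 𝟙 _ :=
  (homologyOpens.{u} k X n).map_id U

variable (k) in
/-- The map `H_{n+1}(W) → H_n(I)` given by the Mayer-Vietoris connecting map, if `W ⊆ U ∪ V` and
`U ∩ V ⊆ I`. -/
def connecting {U V I W : Opens X} (hW : W ≤ U ⊔ V) (hI : U ⊓ V ≤ I) (n : ℕ) :
    (homologyOpens.{u} k X (n + 1)).obj W ⟶ (homologyOpens.{u} k X n).obj I :=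
  homologyRes.{u} k hW (n + 1) ≫ mvConnecting.{u} k U V n ≫ homologyRes.{u} k hI n

variable (k) in
/-- The connecting map of the homology sequence of `mvComplex`. -/
def smallConnecting (U V : Opens X) (n : ℕ) :
    (mvComplex.{u} k U V).X₃.homology (n + 1) ⟶ (homologyOpens.{u} k X n).obj (U ⊓ V) :=
  (mvComplex_shortExact.{u} U V).δ (n + 1) n rfl

theorem mvConnecting_eq (U V : Opens X) (n : ℕ) :
    mvConnecting.{u} k U V n = inv (smallHomologyMap.{u} k U V (n + 1)) ≫
      smallConnecting.{u} k U V n :=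
  dif_pos (isIso_smallHomologyMap U V (n + 1))

theorem chainsDiff_biprod_map {U V U' V' : Opens X} (hU : U ≤ U') (hV : V ≤ V') :
    chainsDiff.{u} k U V ≫ biprod.map (chainsMap.{u} k hU) (chainsMap.{u} k hV) =
      chainsMap.{u} k (inf_le_inf hU hV) ≫ chainsDiff.{u} k U' V' := by
  unfold chainsDiff
  refine biprod.hom_ext _ _ ?_ ?_
  · simp only [Category.assoc, biprod.map_fst, biprod.lift_fst, biprod.lift_fst_assoc]
    rw [chainsMap_comp, chainsMap_comp]
  · simp only [Category.assoc, biprod.map_snd, biprod.lift_snd, biprod.lift_snd_assoc,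
      Preadditive.neg_comp, Preadditive.comp_neg]
    rw [chainsMap_comp, chainsMap_comp]

theorem biprod_map_chainsSum {U V U' V' : Opens X} (hU : U ≤ U') (hV : V ≤ V') :
    biprod.map (chainsMap.{u} k hU) (chainsMap.{u} k hV) ≫ chainsSum.{u} k U' V' =
      chainsSum.{u} k U V ≫ chainsMap.{u} k (sup_le_sup hU hV) := by
  unfold chainsSum
  refine biprod.hom_ext' _ _ ?_ ?_
  · simp only [biprod.inl_map_assoc, biprod.inl_desc, biprod.inl_desc_assoc]
    rw [chainsMap_comp, chainsMap_comp]
  · simp only [biprod.inr_map_assoc, biprod.inr_desc, biprod.inr_desc_assoc]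
    rw [chainsMap_comp, chainsMap_comp]

variable (k) in
/-- The morphism between the short exact sequences of two covers, one contained in the other. -/
def mvComplexMap {U V U' V' : Opens X} (hU : U ≤ U') (hV : V ≤ V') :
    mvComplex.{u} k U V ⟶ mvComplex.{u} k U' V' where
  τ₁ := chainsMap.{u} k (inf_le_inf hU hV)
  τ₂ := biprod.map (chainsMap.{u} k hU) (chainsMap.{u} k hV)
  τ₃ := cokernel.map _ _ (chainsMap.{u} k (inf_le_inf hU hV))
    (biprod.map (chainsMap.{u} k hU) (chainsMap.{u} k hV)) (chainsDiff_biprod_map hU hV)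
  comm₁₂ := (chainsDiff_biprod_map hU hV).symm
  comm₂₃ := (cokernel.π_desc _ _ _).symm

theorem mvComplexMap_smallChainsMap {U V U' V' : Opens X} (hU : U ≤ U') (hV : V ≤ V') :
    (mvComplexMap.{u} k hU hV).τ₃ ≫ smallChainsMap.{u} k U' V' =
      smallChainsMap.{u} k U V ≫ chainsMap.{u} k (sup_le_sup hU hV) := by
  have : Epi (mvComplex.{u} k U V).g := (mvComplex_shortExact.{u} U V).epi_g
  have h1 : (mvComplex.{u} k U V).g ≫ smallChainsMap.{u} k U V = chainsSum.{u} k U V :=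
    cokernel_π_smallChainsMap U V
  have h2 : (mvComplex.{u} k U' V').g ≫ smallChainsMap.{u} k U' V' = chainsSum.{u} k U' V' :=
    cokernel_π_smallChainsMap U' V'
  rw [← cancel_epi (mvComplex.{u} k U V).g, ← Category.assoc, ← (mvComplexMap.{u} k hU hV).comm₂₃,
    ← Category.assoc, h1, Category.assoc, h2]
  exact biprod_map_chainsSum hU hV

theorem mvConnecting_naturality {U V U' V' : Opens X} (hU : U ≤ U') (hV : V ≤ V') (n : ℕ) :
    mvConnecting.{u} k U V n ≫ homologyRes.{u} k (inf_le_inf hU hV) n =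
      homologyRes.{u} k (sup_le_sup hU hV) (n + 1) ≫ mvConnecting.{u} k U' V' n := by
  have h1 := HomologicalComplex.HomologySequence.δ_naturality (mvComplexMap.{u} k hU hV)
    (mvComplex_shortExact.{u} U V) (mvComplex_shortExact.{u} U' V') (n + 1) n rfl
  have h2 := congrArg (fun f => HomologicalComplex.homologyMap f (n + 1))
    (mvComplexMap_smallChainsMap.{u} (k := k) hU hV)
  simp only [HomologicalComplex.homologyMap_comp] at h2
  have h3 : inv (smallHomologyMap.{u} k U V (n + 1)) ≫
      HomologicalComplex.homologyMap (mvComplexMap.{u} k hU hV).τ₃ (n + 1) =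
      homologyRes.{u} k (sup_le_sup hU hV) (n + 1) ≫
        inv (smallHomologyMap.{u} k U' V' (n + 1)) := by
    rw [IsIso.inv_comp_eq, ← Category.assoc, IsIso.eq_comp_inv]
    exact h2
  rw [mvConnecting_eq, mvConnecting_eq, Category.assoc, ← Category.assoc (homologyRes.{u} k _ _),
    ← h3, Category.assoc]
  exact congrArg _ h1

theorem connecting_naturality {U V I W U' V' I' W' : Opens X} (hW : W ≤ U ⊔ V) (hI : U ⊓ V ≤ I)
    (hW' : W' ≤ U' ⊔ V') (hI' : U' ⊓ V' ≤ I') (hUU : U ≤ U') (hVV : V ≤ V') (hII : I ≤ I')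
    (hWW : W ≤ W') (n : ℕ) :
    connecting.{u} k hW hI n ≫ homologyRes.{u} k hII n =
      homologyRes.{u} k hWW (n + 1) ≫ connecting.{u} k hW' hI' n := by
  unfold connecting
  rw [Category.assoc, Category.assoc, homologyRes_comp,
    ← homologyRes_comp (inf_le_inf hUU hVV) hI', ← Category.assoc (mvConnecting.{u} k U V n),
    mvConnecting_naturality hUU hVV, ← Category.assoc, ← Category.assoc, homologyRes_comp,
    ← Category.assoc, ← Category.assoc, homologyRes_comp, Category.assoc]

/-! ### Exactness -/

variable (k) in
/-- The map `H_n(I) → H_n(U) ⊕ H_n(V)`, `a ↦ (a, -a)`. -/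
abbrev homologyDiff {U V I : Opens X} (hU : I ≤ U) (hV : I ≤ V) (n : ℕ) :
    (homologyOpens.{u} k X n).obj I →ₗ[k]
      (homologyOpens.{u} k X n).obj U × (homologyOpens.{u} k X n).obj V :=
  (homologyRes.{u} k hU n).hom.prod (-(homologyRes.{u} k hV n).hom)

variable (k) in
/-- The map `H_n(U) ⊕ H_n(V) → H_n(W)`, `(a, b) ↦ a + b`. -/
abbrev homologySum {U V W : Opens X} (hU : U ≤ W) (hV : V ≤ W) (n : ℕ) :
    (homologyOpens.{u} k X n).obj U × (homologyOpens.{u} k X n).obj V →ₗ[k]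
      (homologyOpens.{u} k X n).obj W :=
  (homologyRes.{u} k hU n).hom.coprod (homologyRes.{u} k hV n).hom

/-- Homology commutes with binary direct sums. -/
theorem exists_homology_biprod_equiv {R : Type w} [Ring R] (A B : ChainComplex (ModuleCat.{v} R) ℕ)
    (n : ℕ) : ∃ e : (A ⊞ B).homology n ≃ₗ[R] A.homology n × B.homology n,
      ∀ y, e y = (HomologicalComplex.homologyMap (biprod.fst : A ⊞ B ⟶ A) n y,
        HomologicalComplex.homologyMap (biprod.snd : A ⊞ B ⟶ B) n y) := by
  have key : ∀ {K L M : ChainComplex (ModuleCat.{v} R) ℕ} (f : K ⟶ L) (g : L ⟶ M) (h : K ⟶ M),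
      f ≫ g = h → ∀ y, HomologicalComplex.homologyMap g n (HomologicalComplex.homologyMap f n y) =
        HomologicalComplex.homologyMap h n y := by
    rintro K L M f g _ rfl y
    rw [HomologicalComplex.homologyMap_comp]
    rfl
  let f : (A ⊞ B).homology n →ₗ[R] A.homology n × B.homology n :=
    (HomologicalComplex.homologyMap (biprod.fst : A ⊞ B ⟶ A) n).hom.prod
      (HomologicalComplex.homologyMap (biprod.snd : A ⊞ B ⟶ B) n).hom
  let g : A.homology n × B.homology n →ₗ[R] (A ⊞ B).homology n :=
    (HomologicalComplex.homologyMap (biprod.inl : A ⟶ A ⊞ B) n).hom.coprod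
      (HomologicalComplex.homologyMap (biprod.inr : B ⟶ A ⊞ B) n).hom
  refine ⟨LinearEquiv.ofLinearMap f g (LinearMap.ext fun ⟨a, b⟩ => ?_)
    (LinearMap.ext fun y => ?_), fun y => rfl⟩
  · refine Prod.ext ?_ ?_
    · change HomologicalComplex.homologyMap (biprod.fst : A ⊞ B ⟶ A) n
        (HomologicalComplex.homologyMap (biprod.inl : A ⟶ A ⊞ B) n a +
          HomologicalComplex.homologyMap (biprod.inr : B ⟶ A ⊞ B) n b) = a
      rw [map_add, key _ _ _ biprod.inl_fst, key _ _ _ biprod.inr_fst]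
      simp
    · change HomologicalComplex.homologyMap (biprod.snd : A ⊞ B ⟶ B) n
        (HomologicalComplex.homologyMap (biprod.inl : A ⟶ A ⊞ B) n a +
          HomologicalComplex.homologyMap (biprod.inr : B ⟶ A ⊞ B) n b) = b
      rw [map_add, key _ _ _ biprod.inl_snd, key _ _ _ biprod.inr_snd]
      simp
  · change HomologicalComplex.homologyMap (biprod.inl : A ⟶ A ⊞ B) n
        (HomologicalComplex.homologyMap (biprod.fst : A ⊞ B ⟶ A) n y) +
      HomologicalComplex.homologyMap (biprod.inr : B ⟶ A ⊞ B) n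
        (HomologicalComplex.homologyMap (biprod.snd : A ⊞ B ⟶ B) n y) = y
    rw [key _ _ _ rfl, key _ _ _ rfl]
    have h := congrArg (fun f => HomologicalComplex.homologyMap f n)
      (biprod.total (X := A) (Y := B))
    simp only [HomologicalComplex.homologyMap_add, HomologicalComplex.homologyMap_id] at h
    exact ConcreteCategory.congr_hom h y

theorem homologyMap_biprod_desc_apply {R : Type w} [Ring R]
    {A B K : ChainComplex (ModuleCat.{v} R) ℕ} (f : A ⟶ K) (g : B ⟶ K) (n : ℕ)
    (y : (A ⊞ B).homology n) :
    HomologicalComplex.homologyMap (biprod.desc f g) n y =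
      HomologicalComplex.homologyMap f n
        (HomologicalComplex.homologyMap (biprod.fst : A ⊞ B ⟶ A) n y) +
      HomologicalComplex.homologyMap g n
        (HomologicalComplex.homologyMap (biprod.snd : A ⊞ B ⟶ B) n y) := by
  rw [biprod.desc_eq, HomologicalComplex.homologyMap_add, HomologicalComplex.homologyMap_comp,
    HomologicalComplex.homologyMap_comp]
  rfl

/-- The middle term of the long exact sequence of `mvComplex` is `H_n(U) ⊕ H_n(V)`, and the two
maps at it are the Mayer-Vietoris maps. -/
theorem exists_homology_mvComplex_equiv (U V : Opens X) (n : ℕ) :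
    ∃ e : (mvComplex.{u} k U V).X₂.homology n ≃ₗ[k]
        (homologyOpens.{u} k X n).obj U × (homologyOpens.{u} k X n).obj V,
      (∀ c, e (HomologicalComplex.homologyMap (mvComplex.{u} k U V).f n c) =
        homologyDiff.{u} k inf_le_left inf_le_right n c) ∧
      ∀ y, smallHomologyMap.{u} k U V n
          (HomologicalComplex.homologyMap (mvComplex.{u} k U V).g n y) =
        homologySum.{u} k le_sup_left le_sup_right n (e y) := by
  obtain ⟨e, he⟩ := exists_homology_biprod_equiv (chains.{u} k U) (chains.{u} k V) n
  refine ⟨e, fun c => ?_, fun y => ?_⟩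
  · refine (he _).trans (Prod.ext ?_ ?_)
    · have h := congrArg (fun f => HomologicalComplex.homologyMap f n)
        (biprod.lift_fst (chainsMap.{u} k (inf_le_left : U ⊓ V ≤ U))
          (-(chainsMap.{u} k (inf_le_right : U ⊓ V ≤ V))))
      simp only [HomologicalComplex.homologyMap_comp] at h
      exact ConcreteCategory.congr_hom h c
    · have h := congrArg (fun f => HomologicalComplex.homologyMap f n)
        (biprod.lift_snd (chainsMap.{u} k (inf_le_left : U ⊓ V ≤ U))
          (-(chainsMap.{u} k (inf_le_right : U ⊓ V ≤ V))))
      simp only [HomologicalComplex.homologyMap_comp, HomologicalComplex.homologyMap_neg] at h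
      exact ConcreteCategory.congr_hom h c
  · have h := (HomologicalComplex.homologyMap_comp (mvComplex.{u} k U V).g
      (smallChainsMap.{u} k U V) n).symm.trans
        (congrArg (fun f => HomologicalComplex.homologyMap f n)
          (cokernel_π_smallChainsMap.{u} (k := k) U V))
    refine (ConcreteCategory.congr_hom h y).trans ((homologyMap_biprod_desc_apply _ _ n y).trans ?_)
    exact (congrArg (homologySum.{u} k le_sup_left le_sup_right n) (he y)).symm

theorem smallHomologyMap_bijective (U V : Opens X) (n : ℕ) :
    Function.Bijective (smallHomologyMap.{u} k U V n) :=
  ConcreteCategory.bijective_of_isIso _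

theorem mvConnecting_smallHomologyMap (U V : Opens X) (n : ℕ)
    (x : (mvComplex.{u} k U V).X₃.homology (n + 1)) :
    mvConnecting.{u} k U V n (smallHomologyMap.{u} k U V (n + 1) x) =
      smallConnecting.{u} k U V n x := by
  have h : smallHomologyMap.{u} k U V (n + 1) ≫ mvConnecting.{u} k U V n =
      smallConnecting.{u} k U V n := by
    rw [mvConnecting_eq, IsIso.hom_inv_id_assoc]
  exact ConcreteCategory.congr_hom h x

theorem exact_mvConnecting_homologyDiff (U V : Opens X) (n : ℕ) :
    Function.Exact (mvConnecting.{u} k U V n).hom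
      (homologyDiff.{u} k (inf_le_left : U ⊓ V ≤ U) inf_le_right n) := by
  obtain ⟨e, he, -⟩ := exists_homology_mvComplex_equiv.{u} (k := k) U V n
  intro c
  refine (Eq.congr_left (he c).symm).trans (e.map_eq_zero_iff.trans ?_)
  refine ((ShortComplex.ShortExact.moduleCat_exact_iff_function_exact _).1
    ((mvComplex_shortExact.{u} (k := k) U V).homology_exact₁ (n + 1) n rfl) c).trans ⟨?_, ?_⟩
  · rintro ⟨x, rfl⟩
    exact ⟨_, mvConnecting_smallHomologyMap U V n x⟩
  · rintro ⟨x, rfl⟩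
    obtain ⟨x, rfl⟩ := (smallHomologyMap_bijective U V (n + 1)).2 x
    exact ⟨x, (mvConnecting_smallHomologyMap U V n x).symm⟩

theorem exact_homologyDiff_homologySum (U V : Opens X) (n : ℕ) :
    Function.Exact (homologyDiff.{u} k (inf_le_left : U ⊓ V ≤ U) inf_le_right n)
      (homologySum.{u} k (le_sup_left : U ≤ U ⊔ V) le_sup_right n) := by
  obtain ⟨e, he, he'⟩ := exists_homology_mvComplex_equiv.{u} (k := k) U V n
  intro p
  obtain ⟨y, rfl⟩ := e.surjective p
  rw [← he', map_eq_zero_iff _ (smallHomologyMap_bijective U V n).1]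
  refine ((ShortComplex.ShortExact.moduleCat_exact_iff_function_exact _).1
    ((mvComplex_shortExact.{u} (k := k) U V).homology_exact₂ n) y).trans ⟨?_, ?_⟩
  · rintro ⟨c, rfl⟩
    exact ⟨c, (he c).symm⟩
  · rintro ⟨c, hc⟩
    exact ⟨c, e.injective ((he c).trans hc)⟩

theorem exact_homologySum_mvConnecting (U V : Opens X) (n : ℕ) :
    Function.Exact (homologySum.{u} k (le_sup_left : U ≤ U ⊔ V) le_sup_right (n + 1))
      (mvConnecting.{u} k U V n).hom := by
  obtain ⟨e, -, he'⟩ := exists_homology_mvComplex_equiv.{u} (k := k) U V (n + 1)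
  intro x
  obtain ⟨x, rfl⟩ := (smallHomologyMap_bijective U V (n + 1)).2 x
  refine (Eq.congr_left (mvConnecting_smallHomologyMap U V n x)).trans ?_
  refine ((ShortComplex.ShortExact.moduleCat_exact_iff_function_exact _).1
    ((mvComplex_shortExact.{u} (k := k) U V).homology_exact₃ (n + 1) n rfl) x).trans ⟨?_, ?_⟩
  · rintro ⟨y, rfl⟩
    exact ⟨e y, (he' y).symm⟩
  · rintro ⟨p, hp⟩
    obtain ⟨y, rfl⟩ := e.surjective p
    exact ⟨y, (smallHomologyMap_bijective U V (n + 1)).1 ((he' y).trans hp)⟩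

theorem homologySum_zero_surjective (U V : Opens X) :
    Function.Surjective (homologySum.{u} k (le_sup_left : U ≤ U ⊔ V) le_sup_right 0) := by
  obtain ⟨e, -, he'⟩ := exists_homology_mvComplex_equiv.{u} (k := k) U V 0
  have : Epi (mvComplex.{u} k U V).g := (mvComplex_shortExact.{u} U V).epi_g
  have hepi := HomologicalComplex.epi_homologyMap_of_epi_of_not_rel (mvComplex.{u} k U V).g 0
    (by simp)
  intro x
  obtain ⟨x, rfl⟩ := (smallHomologyMap_bijective U V 0).2 x
  obtain ⟨y, rfl⟩ := (ModuleCat.epi_iff_surjective _).1 hepi x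
  exact ⟨e y, (he' y).symm⟩

end MayerVietorisSequence

section Connecting

variable {k : Type w} [Field k] {X : Type u} [TopologicalSpace X]

theorem connecting_sup_inf (U V : Opens X) (n : ℕ) :
    connecting.{u} k (le_refl (U ⊔ V)) (le_refl (U ⊓ V)) n = mvConnecting.{u} k U V n := by
  rw [connecting, homologyRes_self, homologyRes_self, Category.id_comp, Category.comp_id]

-- The hypotheses force `I = U ⊓ V` and `W = U ⊔ V`. These equalities hold for the level sets, but
-- not by definition.
variable {U V I W : Opens X} (hW : W ≤ U ⊔ V) (hI : U ⊓ V ≤ I)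
  (hU : I ≤ U) (hV : I ≤ V) (hUW : U ≤ W) (hVW : V ≤ W)

include hUW hVW in
theorem exact_connecting_homologyDiff (n : ℕ) :
    Function.Exact (connecting.{u} k hW hI n).hom (homologyDiff.{u} k hU hV n) := by
  obtain rfl : I = U ⊓ V := le_antisymm (le_inf hU hV) hI
  obtain rfl : W = U ⊔ V := le_antisymm hW (sup_le hUW hVW)
  rw [connecting_sup_inf]
  exact exact_mvConnecting_homologyDiff U V n

include hW hI in
theorem exact_homologyDiff_homologySum_of_eq (n : ℕ) :
    Function.Exact (homologyDiff.{u} k hU hV n) (homologySum.{u} k hUW hVW n) := by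
  obtain rfl : I = U ⊓ V := le_antisymm (le_inf hU hV) hI
  obtain rfl : W = U ⊔ V := le_antisymm hW (sup_le hUW hVW)
  exact exact_homologyDiff_homologySum U V n

include hU hV in
theorem exact_homologySum_connecting (n : ℕ) :
    Function.Exact (homologySum.{u} k hUW hVW (n + 1)) (connecting.{u} k hW hI n).hom := by
  obtain rfl : I = U ⊓ V := le_antisymm (le_inf hU hV) hI
  obtain rfl : W = U ⊔ V := le_antisymm hW (sup_le hUW hVW)
  rw [connecting_sup_inf]
  exact exact_homologySum_mvConnecting U V n

include hW in
theorem homologySum_zero_surjective_of_eq :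
    Function.Surjective (homologySum.{u} k hUW hVW 0) := by
  obtain rfl : W = U ⊔ V := le_antisymm hW (sup_le hUW hVW)
  exact homologySum_zero_surjective U V

end Connecting

/-! ### The Mayer-Vietoris system of a continuous function and its stability -/

section LevelSetSystem

variable {k : Type w} [Field k] {X : Type u} [TopologicalSpace X]

instance (h : C(X, ℝ)) (n : ℕ) (x : DeltaPlus) :
    Subsingleton ((levelSetPers.{u} k h (Int.negSucc n)).obj x) :=
  inferInstanceAs (Subsingleton PUnit)

theorem levelSetData_isMVSystem (h : C(X, ℝ)) : (levelSetData.{u} k h).IsMVSystem where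
  naturality i s x y hxy := by
    cases i with
    | ofNat n =>
      exact congrArg ModuleCat.Hom.hom (connecting_naturality.{u} (k := k)
        (levelSet_le_sup h s x) (levelSet_inf_le h s x)
        (levelSet_le_sup h s y) (levelSet_inf_le h s y)
        (levelSet_mono h (DeltaPlus.add_le_add hxy le_rfl))
        (levelSet_mono h (DeltaPlus.add_le_add hxy le_rfl))
        (levelSet_mono h hxy) (levelSet_mono h (DeltaPlus.add_le_add hxy le_rfl)) n)
    | negSucc n =>
      exact LinearMap.ext fun a =>
        Subsingleton.elim (α := (levelSetPers.{u} k h (Int.negSucc n)).obj y) _ _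
  exact_left i s x := by
    cases i with
    | ofNat n =>
      exact exact_connecting_homologyDiff (levelSet_le_sup h s x) (levelSet_inf_le h s x)
        (levelSet_mono h (x.le_add s.x)) (levelSet_mono h (x.le_add s.y))
        (levelSet_mono h (DeltaPlus.add_le_add le_rfl s.x_le))
        (levelSet_mono h (DeltaPlus.add_le_add le_rfl s.y_le)) n
    | negSucc n =>
      intro b
      obtain rfl : b = 0 :=
        Subsingleton.elim (α := (levelSetPers.{u} k h (Int.negSucc n)).obj x) _ _
      exact iff_of_true (map_zero _) ⟨0, map_zero _⟩
  exact_middle i s x := by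
    cases i with
    | ofNat n =>
      exact exact_homologyDiff_homologySum_of_eq (levelSet_le_sup h s x) (levelSet_inf_le h s x)
        (levelSet_mono h (x.le_add s.x)) (levelSet_mono h (x.le_add s.y))
        (levelSet_mono h (DeltaPlus.add_le_add le_rfl s.x_le))
        (levelSet_mono h (DeltaPlus.add_le_add le_rfl s.y_le)) n
    | negSucc n =>
      intro b
      obtain rfl : b = 0 :=
        Subsingleton.elim (α := (levelSetPers.{u} k h (Int.negSucc n)).obj (x.add s.x) ×
          (levelSetPers.{u} k h (Int.negSucc n)).obj (x.add s.y)) _ _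
      exact iff_of_true (map_zero _) ⟨0, map_zero _⟩
  exact_right i s x := by
    rcases i with n | _ | n
    · exact exact_homologySum_connecting (levelSet_le_sup h s x) (levelSet_inf_le h s x)
        (levelSet_mono h (x.le_add s.x)) (levelSet_mono h (x.le_add s.y))
        (levelSet_mono h (DeltaPlus.add_le_add le_rfl s.x_le))
        (levelSet_mono h (DeltaPlus.add_le_add le_rfl s.y_le)) n
    -- For `i = -1` the connecting map is zero, and the sum map has to be onto `H_0`.
    · intro b
      exact iff_of_true rfl (homologySum_zero_surjective_of_eq.{u} (k := k)
        (levelSet_le_sup h s x) (levelSet_mono h (DeltaPlus.add_le_add le_rfl s.x_le))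
        (levelSet_mono h (DeltaPlus.add_le_add le_rfl s.y_le)) b)
    · intro b
      obtain rfl : b = 0 :=
        Subsingleton.elim (α := (levelSetPers.{u} k h (Int.negSucc n)).obj (x.add s.1)) _ _
      exact iff_of_true rfl ⟨0, map_zero _⟩
  compat i s t hst x := by
    cases i with
    | ofNat n =>
      have H := connecting_naturality.{u} (k := k)
        (levelSet_le_sup h s x) (levelSet_inf_le h s x)
        (levelSet_le_sup h t x) (levelSet_inf_le h t x)
        (levelSet_mono h (DeltaPlus.add_le_add le_rfl ⟨hst.1, le_rfl⟩))
        (levelSet_mono h (DeltaPlus.add_le_add le_rfl ⟨le_rfl, hst.2⟩))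
        le_rfl (levelSet_mono h (DeltaPlus.add_le_add le_rfl hst)) n
      rw [homologyRes_self, Category.comp_id] at H
      exact (congrArg ModuleCat.Hom.hom H).symm
    | negSucc n =>
      exact LinearMap.ext fun a =>
        Subsingleton.elim (α := (levelSetPers.{u} k h (Int.negSucc n)).obj x) _ _

theorem MVSystem.dI_le {S T : MVSystem.{v} k} {ε : ℝ≥0} (h : MVSystem.Interleaved ε S T) :
    S.dI T ≤ ε :=
  iInf₂_le (f := fun (ε : ℝ≥0) (_ : MVSystem.Interleaved ε S T) => (ε : ℝ≥0∞)) ε h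

variable (k) in
/-- The Mayer-Vietoris system of a continuous function. -/
def levelSetSystem (h : C(X, ℝ)) : MVSystem.{max w u} k :=
  ⟨levelSetData.{u} k h, levelSetData_isMVSystem h⟩

theorem levelSet_le_levelSet_add {h h' : C(X, ℝ)} {ε : ℝ≥0} (hε : ∀ a, |h a - h' a| ≤ ε)
    (x : DeltaPlus) : levelSet h x ≤ levelSet h' (x.add (diag ε)) := by
  rintro a ⟨h1, h2⟩
  have h3 := abs_le.1 (hε a)
  constructor
  · change -(x.1.1 + (ε : ℝ)) < h' a
    linarith [h3.2]
  · change h' a < x.1.2 + (ε : ℝ)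
    linarith [h3.1]

variable (k) in
/-- The morphism `M^h → M^{h'}[(ε, ε)]` induced by the inclusions of level sets, if
`|h - h'| ≤ ε`. -/
def levelSetHom {h h' : C(X, ℝ)} {ε : ℝ≥0} (hε : ∀ a, |h a - h' a| ≤ ε) :
    (levelSetSystem.{u} k h).Hom ((levelSetSystem.{u} k h').shift (diag ε)) where
  app
    | Int.ofNat n =>
      { app := fun x => homologyRes.{u} k (levelSet_le_levelSet_add hε x) n
        naturality := fun x y f => (homologyRes_comp.{u} (k := k) _ _ n).trans
          (homologyRes_comp.{u} (k := k) (levelSet_le_levelSet_add hε x)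
            (levelSet_mono h' (DeltaPlus.add_le_add (leOfHom f) le_rfl)) n).symm }
    | Int.negSucc _ => 𝟙 ((Functor.const _).obj (ModuleCat.of k PUnit))
  comm i s x := by
    cases i with
    | ofNat n =>
      have hx : levelSet h' ((x.add s.1).add (diag ε)) ≤ levelSet h' ((x.add (diag ε)).add s.1) :=
        levelSet_mono h' (DeltaPlus.add_right_comm x s.1 (diag ε)).le
      have H := connecting_naturality.{u} (k := k)
        (levelSet_le_sup h s x) (levelSet_inf_le h s x)
        (levelSet_le_sup h' s (x.add (diag ε))) (levelSet_inf_le h' s (x.add (diag ε)))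
        ((levelSet_le_levelSet_add hε _).trans
          (levelSet_mono h' (DeltaPlus.add_right_comm x s.x (diag ε)).le))
        ((levelSet_le_levelSet_add hε _).trans
          (levelSet_mono h' (DeltaPlus.add_right_comm x s.y (diag ε)).le))
        (levelSet_le_levelSet_add hε x) ((levelSet_le_levelSet_add hε _).trans hx) n
      rw [← homologyRes_comp (levelSet_le_levelSet_add hε _) hx, Category.assoc] at H
      exact congrArg ModuleCat.Hom.hom H
    | negSucc n =>
      exact LinearMap.ext fun a =>
        Subsingleton.elim (α := (levelSetPers.{u} k h' (Int.negSucc n)).obj (x.add (diag ε))) _ _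

theorem levelSetHom_comp {h h' : C(X, ℝ)} {ε : ℝ≥0} (hε : ∀ a, |h a - h' a| ≤ ε)
    (hε' : ∀ a, |h' a - h a| ≤ ε) (i : ℤ) (x : DeltaPlus) :
    (((levelSetHom.{u} k hε').app i).app (x.add (diag ε))).hom ∘ₗ
        (((levelSetHom.{u} k hε).app i).app x).hom =
      ((levelSetSystem.{u} k h).mod i).str
        ((x.le_add (diag ε)).trans (DeltaPlus.le_add _ (diag ε))) := by
  cases i with
  | ofNat n => exact congrArg ModuleCat.Hom.hom (homologyRes_comp.{u} (k := k)
      (levelSet_le_levelSet_add hε x) (levelSet_le_levelSet_add hε' (x.add (diag ε))) n)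
  | negSucc n =>
    exact LinearMap.ext fun a => Subsingleton.elim
      (α := (levelSetPers.{u} k h (Int.negSucc n)).obj ((x.add (diag ε)).add (diag ε))) _ _

theorem interleaved_levelSetSystem {h h' : C(X, ℝ)} {ε : ℝ≥0} (hε : ∀ a, |h a - h' a| ≤ ε) :
    MVSystem.Interleaved ε (levelSetSystem.{u} k h) (levelSetSystem.{u} k h') :=
  have hε' : ∀ a, |h' a - h a| ≤ ε := fun a => abs_sub_comm (h a) (h' a) ▸ hε a
  ⟨levelSetHom.{u} k hε, levelSetHom.{u} k hε', levelSetHom_comp hε hε', levelSetHom_comp hε' hε⟩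

end LevelSetSystem

end MV

end

theorem propositionP {k : Type w} [Field k] {X : Type u} [TopologicalSpace X]
    (h₁ h₂ : C(X, ℝ)) :
    ∃ (H₁ : (MV.levelSetData.{u} k h₁).IsMVSystem) (H₂ : (MV.levelSetData.{u} k h₂).IsMVSystem),
      MV.MVSystem.dI ⟨MV.levelSetData.{u} k h₁, H₁⟩ ⟨MV.levelSetData.{u} k h₂, H₂⟩ ≤
        ⨆ x : X, ENNReal.ofReal |h₁ x - h₂ x| := by
  refine ⟨MV.levelSetData_isMVSystem h₁, MV.levelSetData_isMVSystem h₂, ?_⟩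
  by_cases htop : ⨆ x : X, ENNReal.ofReal |h₁ x - h₂ x| = ⊤
  · rw [htop]
    exact le_top
  -- A finite supremum is itself an admissible interleaving parameter.
  · have hε : ∀ a, |h₁ a - h₂ a| ≤ (⨆ x : X, ENNReal.ofReal |h₁ x - h₂ x|).toNNReal := fun a =>
      (ENNReal.ofReal_le_iff_le_toReal htop).1
        (le_iSup (fun x : X => ENNReal.ofReal |h₁ x - h₂ x|) a)
    exact (MV.MVSystem.dI_le (MV.interleaved_levelSetSystem.{u} (k := k) hε)).trans_eq
      (ENNReal.coe_toNNReal htop)
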